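/- For a prime $p$ let $\mathbb{Z}[\tfrac1p]\subset\mathbb{Q}$ be the ring of fractions $a/p^n$ ($a\in\mathbb{Z}$, $n\ge 0$), and let $\tilde G_p\le GL(5,\mathbb{Q})$ be the group of all matrices $$\begin{pmatrix} 1 & x_{12} & x_{13} & x_{14} & x_{15}\\ 0 & p^n & x_{23} & x_{24} & x_{25}\\ 0&0&p^k&x_{34}&x_{35}\\ 0&0&0&1&m\\ 0&0&0&0&1\end{pmatrix},\qquad x_{ij}\in\mathbb{Z}[\tfrac1p],\ n,k,m\in\mathbb{Z}.$$ Let $U(n)$, $n\ge 1$, be the group of unitary $n\times n$ complex matrices with the normalized Hilbert-Schmidt metric $d_n(u,v)=\big(\tfrac1n\operatorname{Tr}((u-v)^*(u-v))\big)^{1/2}$. An asymptotic homomorphism of a group $G$ is a sequence of maps $\pi_k:G\to U(n_k)$ with $\lim_k d_{n_k}(\pi_k(gh),\pi_k(g)\pi_k(h))=0$ for all $g,h\in G$. The group $G$ is HS-stable if for every asymptotic homomorphism $(\pi_k)$ there are homomorphisms $\sigma_k:G\to U(n_k)$ with $\lim_k d_{n_k}(\sigma_k(g),\pi_k(g))=0$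 for all $g\in G$. It is locally HS-stable if for every asymptotic homomorphism $(\pi_k)$ there are maps $\sigma_k:G\to U(n_k)$ with $\lim_k d_{n_k}(\sigma_k(g),\pi_k(g))=0$ for all $g\in G$, such that for all $g,h\in G$ one has $\sigma_k(gh)=\sigma_k(g)\sigma_k(h)$ for all sufficiently large $k$. Theorem B. There are infinitely many pairwise non-isomorphic finitely presented solvable subgroups of $GL(5,\mathbb{Q})$ that are residually finite and not locally HS-stable, hence not HS-stable. Namely, for every prime $p$ the group $\tilde G_p$ is finitely presented, solvable, residually finite, not locally HS-stable and not HS-stable, and $\tilde G_p\not\cong\tilde G_q$ for distinct primes $p\ne q$. -/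

import Mathlib

open Filter Topology

/-- The ring `ℤ[1/p]`, as a subring of `ℚ`: all fractions `a / p ^ n`. -/
def zInvP (p : Nat.Primes) : Subring ℚ where
  carrier := {x | ∃ (a : ℤ) (n : ℕ), x = a / (p : ℚ) ^ n}
  mul_mem' := by
    rintro _ _ ⟨a, n, rfl⟩ ⟨b, m, rfl⟩
    exact ⟨a * b, n + m, by push_cast; rw [pow_add, div_mul_div_comm]⟩
  one_mem' := ⟨1, 0, by simp⟩
  add_mem' := by
    rintro _ _ ⟨a, n, rfl⟩ ⟨b, m, rfl⟩
    have hp : (p : ℚ) ≠ 0 := by exact_mod_cast p.2.ne_zero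
    refine ⟨a * p ^ m + b * p ^ n, n + m, ?_⟩
    push_cast
    rw [pow_add]
    field_simp
  zero_mem' := ⟨0, 0, by simp⟩
  neg_mem' := by
    rintro _ ⟨a, n, rfl⟩
    exact ⟨-a, n, by push_cast; rw [neg_div]⟩

theorem zpow_mem_zInvP (p : Nat.Primes) (n : ℤ) : (p : ℚ) ^ n ∈ zInvP p := by
  rcases n with n | n
  · exact ⟨(p : ℤ) ^ n, 0, by simp⟩
  · exact ⟨1, n + 1, by simp [zpow_negSucc]⟩

/-- The upper triangular matrix with diagonal `1, p ^ n, p ^ k, 1, 1`, with `(4, 5)` entry the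
integer `m`, and with the remaining entries above the diagonal as given. -/
def tildeGMatrix (p : Nat.Primes) (n k m : ℤ)
    (x₁₂ x₁₃ x₁₄ x₁₅ x₂₃ x₂₄ x₂₅ x₃₄ x₃₅ : ℚ) : Matrix (Fin 5) (Fin 5) ℚ :=
  !![1, x₁₂, x₁₃, x₁₄, x₁₅;
     0, (p : ℚ) ^ n, x₂₃, x₂₄, x₂₅;
     0, 0, (p : ℚ) ^ k, x₃₄, x₃₅;
     0, 0, 0, 1, (m : ℚ);
     0, 0, 0, 0, 1]

theorem tildeGMatrix_mul (p : Nat.Primes) (n k m n' k' m' : ℤ)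
    (a₁₂ a₁₃ a₁₄ a₁₅ a₂₃ a₂₄ a₂₅ a₃₄ a₃₅ b₁₂ b₁₃ b₁₄ b₁₅ b₂₃ b₂₄ b₂₅ b₃₄ b₃₅ : ℚ) :
    tildeGMatrix p n k m a₁₂ a₁₃ a₁₄ a₁₅ a₂₃ a₂₄ a₂₅ a₃₄ a₃₅ *
      tildeGMatrix p n' k' m' b₁₂ b₁₃ b₁₄ b₁₅ b₂₃ b₂₄ b₂₅ b₃₄ b₃₅ =
    tildeGMatrix p (n + n') (k + k') (m + m')
      (b₁₂ + a₁₂ * (p : ℚ) ^ n')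
      (b₁₃ + a₁₂ * b₂₃ + a₁₃ * (p : ℚ) ^ k')
      (b₁₄ + a₁₂ * b₂₄ + a₁₃ * b₃₄ + a₁₄)
      (b₁₅ + a₁₂ * b₂₅ + a₁₃ * b₃₅ + a₁₄ * m' + a₁₅)
      ((p : ℚ) ^ n * b₂₃ + a₂₃ * (p : ℚ) ^ k')
      ((p : ℚ) ^ n * b₂₄ + a₂₃ * b₃₄ + a₂₄)
      ((p : ℚ) ^ n * b₂₅ + a₂₃ * b₃₅ + a₂₄ * m' + a₂₅)
      ((p : ℚ) ^ k * b₃₄ + a₃₄)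
      ((p : ℚ) ^ k * b₃₅ + a₃₄ * m' + a₃₅) := by
  have hp : (p : ℚ) ≠ 0 := by exact_mod_cast p.2.ne_zero
  ext i j
  fin_cases i <;> fin_cases j <;>
    simp [tildeGMatrix, Matrix.mul_apply, Fin.sum_univ_five, zpow_add₀ hp, add_comm]

/-- The group `G̃_p` of all matrices as above with entries in `ℤ[1/p]`, as a subgroup of
`GL(5, ℚ)`. -/
def tildeG (p : Nat.Primes) : Subgroup (GL (Fin 5) ℚ) where
  carrier := {g | ∃ n k m : ℤ, ∃ x₁₂ ∈ zInvP p, ∃ x₁₃ ∈ zInvP p, ∃ x₁₄ ∈ zInvP p,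
    ∃ x₁₅ ∈ zInvP p, ∃ x₂₃ ∈ zInvP p, ∃ x₂₄ ∈ zInvP p, ∃ x₂₅ ∈ zInvP p,
    ∃ x₃₄ ∈ zInvP p, ∃ x₃₅ ∈ zInvP p,
    (g : Matrix (Fin 5) (Fin 5) ℚ) =
      tildeGMatrix p n k m x₁₂ x₁₃ x₁₄ x₁₅ x₂₃ x₂₄ x₂₅ x₃₄ x₃₅}
  one_mem' := by
    refine ⟨0, 0, 0, 0, zero_mem _, 0, zero_mem _, 0, zero_mem _, 0, zero_mem _, 0, zero_mem _,
      0, zero_mem _, 0, zero_mem _, 0, zero_mem _, 0, zero_mem _, ?_⟩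
    ext i j
    fin_cases i <;> fin_cases j <;> simp [tildeGMatrix]
  mul_mem' := by
    rintro g h ⟨n, k, m, a₁₂, h₁₂, a₁₃, h₁₃, a₁₄, h₁₄, a₁₅, h₁₅, a₂₃, h₂₃, a₂₄, h₂₄, a₂₅, h₂₅,
      a₃₄, h₃₄, a₃₅, h₃₅, hg⟩
      ⟨n', k', m', b₁₂, i₁₂, b₁₃, i₁₃, b₁₄, i₁₄, b₁₅, i₁₅, b₂₃, i₂₃, b₂₄, i₂₄, b₂₅, i₂₅,
      b₃₄, i₃₄, b₃₅, i₃₅, hh⟩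
    have hz := zpow_mem_zInvP p
    have hm : (m' : ℚ) ∈ zInvP p := intCast_mem _ m'
    refine ⟨n + n', k + k', m + m', _, ?_, _, ?_, _, ?_, _, ?_, _, ?_, _, ?_, _, ?_, _, ?_,
      _, ?_, by rw [Units.val_mul, hg, hh]; exact tildeGMatrix_mul ..⟩ <;>
    repeat' first
      | assumption
      | exact hz _
      | apply add_mem
      | apply mul_mem
  inv_mem' := by
    rintro g ⟨n, k, m, a₁₂, h₁₂, a₁₃, h₁₃, a₁₄, h₁₄, a₁₅, h₁₅, a₂₃, h₂₃, a₂₄, h₂₄, a₂₅, h₂₅,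
      a₃₄, h₃₄, a₃₅, h₃₅, hg⟩
    have hz := zpow_mem_zInvP p
    have hm : (m : ℚ) ∈ zInvP p := intCast_mem _ m
    have hp : (p : ℚ) ≠ 0 := by exact_mod_cast p.2.ne_zero
    let N : ℚ := (p : ℚ) ^ (-n)
    let K : ℚ := (p : ℚ) ^ (-k)
    have hN : N ∈ zInvP p := hz _
    have hK : K ∈ zInvP p := hz _
    let b₃₄ : ℚ := -(K * a₃₄)
    let b₃₅ : ℚ := -(K * (a₃₅ + a₃₄ * -m))
    let b₂₃ : ℚ := -(N * (a₂₃ * K))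
    let b₂₄ : ℚ := -(N * (a₂₄ + a₂₃ * b₃₄))
    let b₂₅ : ℚ := -(N * (a₂₅ + a₂₄ * -m + a₂₃ * b₃₅))
    have i₃₄ : b₃₄ ∈ zInvP p := neg_mem (mul_mem hK h₃₄)
    have i₃₅ : b₃₅ ∈ zInvP p := neg_mem (mul_mem hK (add_mem h₃₅ (mul_mem h₃₄ (neg_mem hm))))
    have i₂₃ : b₂₃ ∈ zInvP p := neg_mem (mul_mem hN (mul_mem h₂₃ hK))
    have i₂₄ : b₂₄ ∈ zInvP p := neg_mem (mul_mem hN (add_mem h₂₄ (mul_mem h₂₃ i₃₄)))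
    have i₂₅ : b₂₅ ∈ zInvP p :=
      neg_mem (mul_mem hN (add_mem (add_mem h₂₅ (mul_mem h₂₄ (neg_mem hm))) (mul_mem h₂₃ i₃₅)))
    refine ⟨-n, -k, -m,
      -(a₁₂ * N), neg_mem (mul_mem h₁₂ hN),
      -(a₁₂ * b₂₃ + a₁₃ * K), neg_mem (add_mem (mul_mem h₁₂ i₂₃) (mul_mem h₁₃ hK)),
      -(a₁₂ * b₂₄ + a₁₃ * b₃₄ + a₁₄),
      neg_mem (add_mem (add_mem (mul_mem h₁₂ i₂₄) (mul_mem h₁₃ i₃₄)) h₁₄),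
      -(a₁₂ * b₂₅ + a₁₃ * b₃₅ + a₁₄ * -m + a₁₅),
      neg_mem (add_mem (add_mem (add_mem (mul_mem h₁₂ i₂₅) (mul_mem h₁₃ i₃₅))
        (mul_mem h₁₄ (neg_mem hm))) h₁₅),
      b₂₃, i₂₃, b₂₄, i₂₄, b₂₅, i₂₅, b₃₄, i₃₄, b₃₅, i₃₅, ?_⟩
    rw [Matrix.coe_units_inv]
    refine Matrix.inv_eq_right_inv ?_
    rw [hg, tildeGMatrix_mul]
    have hn : (p : ℚ) ^ n ≠ 0 := zpow_ne_zero _ hp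
    have hk : (p : ℚ) ^ k ≠ 0 := zpow_ne_zero _ hp
    ext i j
    fin_cases i <;> fin_cases j <;>
      simp [tildeGMatrix, b₂₃, b₂₄, b₂₅, b₃₄, b₃₅, N, K] <;> field_simp <;> ring

/-- The normalized Hilbert-Schmidt distance on `U(n)`: the square root of the normalized trace
of `(u - v)* (u - v)`. That trace is a nonnegative real number. -/
noncomputable def hsDist {n : ℕ} (u v : Matrix.unitaryGroup (Fin n) ℂ) : ℝ :=
  Real.sqrt ((Matrix.trace ((u - v : Matrix (Fin n) (Fin n) ℂ).conjTranspose *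
    (u - v : Matrix (Fin n) (Fin n) ℂ))).re / n)

/-- A sequence of maps `π_k : G → U(n_k)` that is asymptotically multiplicative in the normalized
Hilbert-Schmidt distance. -/
def IsHSAsymptoticHom {G : Type*} [Group G] (n : ℕ → ℕ)
    (π : ∀ k, G → Matrix.unitaryGroup (Fin (n k)) ℂ) : Prop :=
  ∀ g h : G, Tendsto (fun k => hsDist (π k (g * h)) (π k g * π k h)) atTop (𝓝 0)

/-- Hilbert-Schmidt stability: every asymptotic homomorphism to unitary groups is asymptotically
close, pointwise, to a sequence of homomorphisms. -/
def IsHSStable (G : Type*) [Group G] : Prop :=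
  ∀ (n : ℕ → ℕ) (π : ∀ k, G → Matrix.unitaryGroup (Fin (n k)) ℂ),
    (∀ k, 0 < n k) → IsHSAsymptoticHom n π →
    ∃ σ : ∀ k, G →* Matrix.unitaryGroup (Fin (n k)) ℂ,
      ∀ g : G, Tendsto (fun k => hsDist (σ k g) (π k g)) atTop (𝓝 0)

/-- Local Hilbert-Schmidt stability: every asymptotic homomorphism to unitary groups is
asymptotically close, pointwise, to a sequence of maps `σ_k : G → U(n_k)` such that for each pair
`g, h` the equation `σ_k (g h) = σ_k (g) σ_k (h)` holds for all large `k`. -/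
def IsLocallyHSStable (G : Type*) [Group G] : Prop :=
  ∀ (n : ℕ → ℕ) (π : ∀ k, G → Matrix.unitaryGroup (Fin (n k)) ℂ),
    (∀ k, 0 < n k) → IsHSAsymptoticHom n π →
    ∃ σ : ∀ k, G → Matrix.unitaryGroup (Fin (n k)) ℂ,
      (∀ g h : G, ∀ᶠ k in atTop, σ k (g * h) = σ k g * σ k h) ∧
      ∀ g : G, Tendsto (fun k => hsDist (σ k g) (π k g)) atTop (𝓝 0)

/-!
Write `R = ℤ[1/p]`, `G = tildeG p`, and `e_ij(r)` for the elementary matrices.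

*Instability.* In a homomorphism of `G` to the unitary group `U(n)` put `U = e_14(1)`,
`W = e_45(1)` and let `Z = e_15(-1)`, `V = e_15(-1/p)`, so that `W U W⁻¹ = Z U` with `Z` central.
A central commutator in `U(n)` has order dividing `n!`
(`unitary_central_commutator_pow_factorial`), because conjugation by `W` multiplies eigenvalues of
`U` by eigenvalues of `Z`. As `e_15(R)` is `p`-divisible, the order of `V` is prime to `p`, and `V`
is a power of `Z = V ^ p`. The elements `Z ^ j U` are all conjugate, since
`W (Z ^ j U) W⁻¹ = Z ^ (j + 1) U`, so `Z ^ j` is within `2 ‖U - 1‖` of `1` for all `j`, and so is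
`V` (`hsDist_central_root_le`). On the other hand the subgroup `e_14(ℤ) e_15(ℤ)` is normal, and the
quotient by it is solvable, hence has Følner sets; the permutations approximating its regular
action form an asymptotic homomorphism with `U = 1` and `V` far from `1`
(`HasFoelnerSets.exists_isHSAsymptoticHom`). By finite presentability, a locally multiplicative
sequence near it would yield honest representations with these properties, up to a small error
(`not_isLocallyHSStable_of_central_roots`).

*Finite presentability.* The torus acts on each `e_ij(R)` with `(i, j)` other than `(1, 4)` and
`(1, 5)` by a nonzero weight, so a Baumslag–Solitar relation for `e_ij(1)` produces a whole
one-parameter subgroup (`OneParam.exists_of_conj_eq_pow`). Two roots whose weights are not opposite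
are contracted by a common torus element, so their commutator relation follows from the one for
generators (`OneParam.comm_of_scaling`, `OneParam.heis_of_scaling`). For the opposite pairs
`(1, 2), (2, c)` and `(1, 3), (3, c)` with `c = 4, 5` the Hall–Witt identity shows
`[e_12(x), e_2c(yz)] = [e_13(xy), e_3c(z)]` (`AbelsColumn.commutator_eq`), whence both depend on the
product of the parameters only and define `e_1c`, which commutes with the other subgroups of its
column (`AbelsColumn.exists_corner`). All words can then be collected into a normal form
(`Frame.mem_normalForms_of_mem_closure`), so the finitely presented group maps isomorphically
onto `G`.

*The remaining claims.* `G` is solvable of derived length at most three; reductions modulo primes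
other than `p` show that it is residually finite; and its center is `e_15(R)`, which is divisible
by `p` and by no other prime, so that `p` is an isomorphism invariant.
-/

/-! ### Følner sets of solvable groups -/

open scoped Classical in
/-- The Følner condition for a discrete group: for each finite `S` and each `ε > 0` there is a
nonempty finite set that every element of `S` maps into itself, up to a proportion `ε`. -/
def HasFoelnerSets (G : Type*) [Group G] : Prop :=
  ∀ (S : Finset G) (ε : ℝ), 0 < ε → ∃ F : Finset G, F.Nonempty ∧
    ∀ g ∈ S, (({x ∈ F | g * x ∉ F} : Finset G).card : ℝ) ≤ ε * F.card

/-- The boxes `{∏ s ∈ S, s ^ a s | a s ≤ n}` have polynomial growth in `n`, so infinitely often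
passing from `n` to `n + 1` adds few elements. -/
theorem hasFoelnerSets_of_commGroup (G : Type*) [CommGroup G] : HasFoelnerSets G := by
  classical
  intro S ε hε
  let B : ℕ → Finset G := fun n =>
    (Fintype.piFinset fun _ : S => Finset.range (n + 1)).image fun a => ∏ s : S, (s : G) ^ a s
  have hmem : ∀ n x, x ∈ B n ↔ ∃ a : S → ℕ, (∀ s, a s < n + 1) ∧ ∏ s : S, (s : G) ^ a s = x := by
    intro n x
    simp [B]
  have hmono : ∀ n, B n ⊆ B (n + 1) := by
    intro n x hx
    obtain ⟨a, ha, rfl⟩ := (hmem _ _).1 hx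
    exact (hmem _ _).2 ⟨a, fun s => (ha s).trans (by omega), rfl⟩
  have hstep : ∀ n, ∀ g ∈ S, ∀ x ∈ B n, g * x ∈ B (n + 1) := by
    intro n g hg x hx
    obtain ⟨a, ha, rfl⟩ := (hmem _ _).1 hx
    refine (hmem _ _).2 ⟨fun s => (if s = ⟨g, hg⟩ then 1 else 0) + a s, fun s => ?_, ?_⟩
    · have := ha s
      dsimp only
      split_ifs <;> omega
    · simp only [pow_add, Finset.prod_mul_distrib, pow_ite, pow_one, pow_zero]
      rw [Finset.prod_ite_eq' Finset.univ (⟨g, hg⟩ : S) (fun s => (s : G))]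
      simp
  have hcard : ∀ n, (B n).card ≤ (n + 1) ^ S.card := by
    intro n
    refine Finset.card_image_le.trans ?_
    simp [Fintype.card_piFinset]
  have hne : ∀ n, (B n).Nonempty := fun n => ⟨_, (hmem n _).2 ⟨fun _ => 0, by simp, rfl⟩⟩
  have key : ∃ n, ((B (n + 1)).card : ℝ) ≤ (1 + ε) * (B n).card := by
    by_contra! h
    have hlow : ∀ n, (1 + ε) ^ n ≤ ((B n).card : ℝ) := by
      intro n
      induction n with
      | zero => simpa using (hne 0).card_pos
      | succ n ih =>
        rw [pow_succ']
        exact (mul_le_mul_of_nonneg_left ih (by positivity)).trans (h n).le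
    have hlim := tendsto_pow_const_div_const_pow_of_one_lt S.card (r := 1 + ε) (by linarith)
    have hev := (hlim.comp (tendsto_add_atTop_nat 1)).eventually
      (gt_mem_nhds (show (0 : ℝ) < 1 / (1 + ε) by positivity))
    obtain ⟨n, hn⟩ := hev.exists
    simp only [Function.comp_apply] at hn
    rw [div_lt_div_iff₀ (by positivity) (by positivity), one_mul, pow_succ, mul_lt_mul_iff_left₀
      (by positivity)] at hn
    refine absurd hn (not_lt.2 ((hlow n).trans ?_))
    exact_mod_cast hcard n
  obtain ⟨n, hn⟩ := key
  refine ⟨B n, hne n, fun g hg => ?_⟩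
  have hinj : ((B n).filter fun x => g * x ∉ B n).card ≤ (B (n + 1) \ B n).card := by
    refine Finset.card_le_card_of_injOn (fun x => g * x) (fun x hx => ?_)
      (fun x _ y _ h => mul_left_cancel h)
    simp only [Finset.coe_filter, Set.mem_ofPred_eq] at hx
    simpa using ⟨hstep n g hg x hx.1, hx.2⟩
  have hsd := Finset.card_sdiff_add_card_eq_card (hmono n)
  have h1 : (((B n).filter fun x => g * x ∉ B n).card : ℝ) ≤ ((B (n + 1) \ B n).card : ℝ) := by
    exact_mod_cast hinj
  have h2 : ((B (n + 1) \ B n).card : ℝ) + (B n).card = (B (n + 1)).card := by exact_mod_cast hsd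
  linarith

/-- The Følner condition passes to extensions: a Følner set of the quotient, lifted to the group
and multiplied by a sufficiently invariant Følner set of the kernel, is a Følner set. -/
theorem HasFoelnerSets.extension {K G Q : Type*} [Group K] [Group G] [Group Q] (i : K →* G)
    (f : G →* Q) (hi : Function.Injective i) (hf : Function.Surjective f) (hif : f.ker ≤ i.range)
    (hif' : i.range ≤ f.ker) (hK : HasFoelnerSets K) (hQ : HasFoelnerSets Q) :
    HasFoelnerSets G := by
  classical
  intro S ε hε
  obtain ⟨F, hF, hFS⟩ := hQ (S.image f) (ε / 2) (by positivity)
  let t : Q → G := Function.surjInv hf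
  have ht : ∀ q, f (t q) = q := Function.surjInv_eq hf
  have hfi : ∀ k, f (i k) = 1 := fun k => hif' ⟨k, rfl⟩
  have hc : ∀ g q, ∃ k, g * t q = t (f g * q) * i k := by
    intro g q
    obtain ⟨k, hk⟩ := hif (show (t (f g * q))⁻¹ * (g * t q) ∈ f.ker by
      simp [MonoidHom.mem_ker, ht])
    exact ⟨k, by rw [hk, mul_inv_cancel_left]⟩
  choose c hc using hc
  obtain ⟨E, hE, hES⟩ := hK ((S ×ˢ F).image fun x => c x.1 x.2) (ε / 2) (by positivity)
  have hinj : Function.Injective fun x : Q × K => t x.1 * i x.2 := by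
    rintro ⟨q, k⟩ ⟨q', k'⟩ h
    have hq : q = q' := by simpa [ht, hfi] using congrArg f h
    subst hq
    simpa using hi (mul_left_cancel h)
  refine ⟨(F ×ˢ E).image fun x => t x.1 * i x.2, (hF.product hE).image _, fun g hg => ?_⟩
  rw [Finset.card_image_of_injective _ hinj, Finset.card_product]
  have hsub : ((F ×ˢ E).image fun x => t x.1 * i x.2).filter
      (fun x => g * x ∉ (F ×ˢ E).image fun x => t x.1 * i x.2) ⊆
      (((F.filter fun q => f g * q ∉ F) ×ˢ E) ∪
        F.biUnion fun q => {q} ×ˢ (E.filter fun k => c g q * k ∉ E)).image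
          fun x => t x.1 * i x.2 := by
    intro x hx
    obtain ⟨hx, hgx⟩ := Finset.mem_filter.1 hx
    obtain ⟨⟨q, k⟩, hqk, rfl⟩ := Finset.mem_image.1 hx
    obtain ⟨hq, hk⟩ := Finset.mem_product.1 hqk
    refine Finset.mem_image_of_mem _ ?_
    by_contra hcon
    simp only [Finset.mem_union, Finset.mem_product, Finset.mem_filter, Finset.mem_biUnion,
      Finset.mem_singleton, not_or, not_exists, not_and, not_not] at hcon
    have h1 := by_contra fun h => hcon.1 ⟨hq, h⟩ hk
    have h2 := hcon.2 q hq rfl hk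
    refine hgx (Finset.mem_image.2 ⟨(f g * q, c g q * k), Finset.mem_product.2 ⟨h1, h2⟩, ?_⟩)
    simp only [map_mul]
    rw [← mul_assoc, ← hc, mul_assoc]
  have hcard : ((((F ×ˢ E).image fun x => t x.1 * i x.2).filter
      (fun x => g * x ∉ (F ×ˢ E).image fun x => t x.1 * i x.2)).card : ℝ) ≤
      (F.filter fun q => f g * q ∉ F).card * E.card +
        ∑ q ∈ F, ((E.filter fun k => c g q * k ∉ E).card : ℝ) := by
    have := (Finset.card_le_card hsub).trans (Finset.card_image_le.trans
      ((Finset.card_union_le _ _).trans (add_le_add le_rfl Finset.card_biUnion_le)))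
    simp only [Finset.card_product, Finset.card_singleton, one_mul] at this
    exact_mod_cast this
  have h1 := hFS (f g) (Finset.mem_image_of_mem _ hg)
  have h2 : ∑ q ∈ F, ((E.filter fun k => c g q * k ∉ E).card : ℝ) ≤
      ∑ q ∈ F, ε / 2 * (E.card : ℝ) := by
    refine Finset.sum_le_sum fun q hq => hES _ (Finset.mem_image.2 ⟨(g, q), ?_, rfl⟩)
    exact Finset.mem_product.2 ⟨hg, hq⟩
  rw [Finset.sum_const, nsmul_eq_mul] at h2
  have h3 := mul_le_mul_of_nonneg_right h1 (Nat.cast_nonneg (α := ℝ) E.card)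
  push_cast
  nlinarith

theorem map_derivedSeries_commutator (G : Type*) [Group G] (n : ℕ) :
    (derivedSeries (commutator G) n).map (commutator G).subtype = derivedSeries G (n + 1) := by
  induction n with
  | zero => rw [derivedSeries_zero, ← MonoidHom.range_eq_map, Subgroup.range_subtype,
      derivedSeries_succ, derivedSeries_zero, commutator_def]
  | succ n ih => rw [derivedSeries_succ, Subgroup.map_commutator, ih, ← derivedSeries_succ]

/-- Solvable groups are amenable. -/
theorem hasFoelnerSets_of_isSolvable (G : Type*) [Group G] [h : Group.IsSolvable G] :
    HasFoelnerSets G := by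
  obtain ⟨n, hn⟩ := h
  induction n generalizing G with
  | zero =>
    intro S ε hε
    have hG : ∀ x : G, x = 1 := fun x => by
      rw [← Subgroup.mem_bot, ← hn]
      exact Subgroup.mem_top x
    refine ⟨{1}, by simp, fun g _ => ?_⟩
    rw [hG g]
    simpa [Finset.filter_singleton] using hε.le
  | succ n ih =>
    refine HasFoelnerSets.extension (commutator G).subtype (Abelianization.of (G := G))
      (commutator G).subtype_injective (QuotientGroup.mk'_surjective _) ?_ ?_ (ih _ ?_)
      (hasFoelnerSets_of_commGroup _)
    · rw [Subgroup.range_subtype, Abelianization.ker_of]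
    · rw [Subgroup.range_subtype, Abelianization.ker_of]
    · rw [← map_derivedSeries_commutator] at hn
      exact (Subgroup.map_eq_bot_iff_of_injective _ (commutator G).subtype_injective).1 hn

/-! ### The Hilbert–Schmidt distance and approximation by permutations -/

section HilbertSchmidt

open scoped Matrix.Norms.Frobenius

theorem hsDist_eq_norm {n : ℕ} (u v : Matrix.unitaryGroup (Fin n) ℂ) :
    hsDist u v = ‖(u - v : Matrix (Fin n) (Fin n) ℂ)‖ / √n := by
  rw [hsDist, Real.sqrt_div', Matrix.frobenius_norm_def, ← Real.sqrt_eq_rpow]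
  · congr 2
    rw [Finset.sum_comm]
    simp [Matrix.trace, Matrix.mul_apply, Complex.mul_re, Complex.sq_norm, Complex.normSq_apply]
    simp only [← Finset.sum_sub_distrib]
    exact Finset.sum_congr rfl fun i _ => Finset.sum_congr rfl fun j _ => by ring
  · positivity

theorem hsDist_comm {n : ℕ} (u v : Matrix.unitaryGroup (Fin n) ℂ) : hsDist u v = hsDist v u := by
  rw [hsDist_eq_norm, hsDist_eq_norm, norm_sub_rev]

theorem hsDist_triangle {n : ℕ} (u v w : Matrix.unitaryGroup (Fin n) ℂ) :
    hsDist u w ≤ hsDist u v + hsDist v w := by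
  simp only [hsDist_eq_norm, ← add_div]
  gcongr
  exact norm_sub_le_norm_sub_add_norm_sub _ _ _

theorem hsDist_nonneg {n : ℕ} (u v : Matrix.unitaryGroup (Fin n) ℂ) : 0 ≤ hsDist u v :=
  Real.sqrt_nonneg _

theorem hsDist_mul_left {n : ℕ} (w u v : Matrix.unitaryGroup (Fin n) ℂ) :
    hsDist (w * u) (w * v) = hsDist u v := by
  have hw : (w : Matrix (Fin n) (Fin n) ℂ).conjTranspose * w = 1 :=
    Matrix.UnitaryGroup.star_mul_self w
  simp only [hsDist, Matrix.UnitaryGroup.mul_val, ← mul_sub, Matrix.conjTranspose_mul]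
  rw [Matrix.mul_assoc, ← Matrix.mul_assoc _ (w : Matrix (Fin n) (Fin n) ℂ), hw, Matrix.one_mul]

theorem hsDist_mul_right {n : ℕ} (u v w : Matrix.unitaryGroup (Fin n) ℂ) :
    hsDist (u * w) (v * w) = hsDist u v := by
  have hw : (w : Matrix (Fin n) (Fin n) ℂ) * (w : Matrix (Fin n) (Fin n) ℂ).conjTranspose = 1 :=
    Matrix.mem_unitaryGroup_iff.1 w.2
  simp only [hsDist, Matrix.UnitaryGroup.mul_val, ← sub_mul, Matrix.conjTranspose_mul]
  rw [Matrix.mul_assoc, Matrix.trace_mul_comm, Matrix.mul_assoc, Matrix.mul_assoc, hw,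
    Matrix.mul_one]

end HilbertSchmidt

/-- The action of permutations on `ℂⁿ` by permutation matrices. `Matrix.permMatrixHom` includes an
inverse, since `Equiv.Perm.permMatrix` is antimultiplicative. -/
noncomputable def permUnitary (n : ℕ) : Equiv.Perm (Fin n) →* Matrix.unitaryGroup (Fin n) ℂ where
  toFun σ := ⟨Matrix.permMatrixHom (R := ℂ) σ, by
    rw [Matrix.mem_unitaryGroup_iff, Matrix.star_eq_conjTranspose, Matrix.permMatrixHom_apply,
      Matrix.conjTranspose_permMatrix, ← Matrix.permMatrix_mul]
    simp⟩
  map_one' := Subtype.ext (map_one _)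
  map_mul' σ τ := Subtype.ext (map_mul _ σ τ)

/-- The squared distance of two permutation matrices is twice the proportion of points at which
the permutations differ. -/
theorem hsDist_permUnitary {n : ℕ} (σ τ : Equiv.Perm (Fin n)) :
    hsDist (permUnitary n σ) (permUnitary n τ) =
      √(2 * ((Finset.univ.filter fun i => σ i ≠ τ i).card : ℝ) / n) := by
  have hval : ∀ (σ : Equiv.Perm (Fin n)) i j,
      (permUnitary n σ : Matrix (Fin n) (Fin n) ℂ) i j = if i = σ j then 1 else 0 := by
    intro σ i j
    simp [permUnitary, PEquiv.toMatrix_apply, Equiv.symm_apply_eq, Equiv.Perm.inv_def]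
  have hcol : ∀ j, ((∑ i, (starRingEnd ℂ) ((if i = σ j then 1 else 0) - if i = τ j then 1 else 0) *
      ((if i = σ j then 1 else 0) - if i = τ j then 1 else 0) : ℂ)).re =
      if σ j ≠ τ j then 2 else 0 := by
    intro j
    by_cases h : σ j = τ j
    · simp [h]
    · have : ∀ i, (starRingEnd ℂ) ((if i = σ j then 1 else 0) - if i = τ j then 1 else 0) *
          ((if i = σ j then 1 else 0) - if i = τ j then 1 else 0) =
          ((if i = σ j then 1 else 0) + if i = τ j then 1 else 0 : ℂ) := by
        intro i
        by_cases h1 : i = σ j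
        · have h2 : i ≠ τ j := fun h2 => h (h1.symm.trans h2)
          simp [h1, h]
        · by_cases h2 : i = τ j <;> simp [h1, h2]
          simp [Ne.symm h]
      simp only [this]
      rw [Finset.sum_add_distrib]
      simp [h]
      norm_num
  rw [hsDist, Matrix.trace]
  congr 2
  simp only [Matrix.diag_apply, Matrix.mul_apply, Matrix.conjTranspose_apply, Matrix.sub_apply,
    hval, RCLike.star_def]
  rw [Complex.re_sum]
  simp only [hcol]
  rw [← Finset.sum_filter, Finset.sum_const, nsmul_eq_mul, mul_comm]

/-- A countable group with Følner sets has permutations approximating its left regular action: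
an asymptotic homomorphism that fixes `1` and moves every `g ≠ 1` away from the identity. -/
theorem HasFoelnerSets.exists_isHSAsymptoticHom {Q : Type*} [Group Q] [Countable Q]
    (hQ : HasFoelnerSets Q) :
    ∃ (n : ℕ → ℕ) (π : ∀ k, Q → Matrix.unitaryGroup (Fin (n k)) ℂ), (∀ k, 0 < n k) ∧
      IsHSAsymptoticHom n π ∧ (∀ k, π k 1 = 1) ∧
      ∀ g, g ≠ 1 → ∀ᶠ k in atTop, 1 ≤ hsDist (π k g) 1 := by
  classical
  obtain ⟨enc, henc⟩ := exists_injective_nat Q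
  have hS : ∀ k : ℕ, ∃ F : Finset Q, F.Nonempty ∧ ∀ g, enc g ≤ k →
      ((F.filter fun x => g * x ∉ F).card : ℝ) ≤ 1 / (k + 1) * F.card := by
    intro k
    have hfin : {g | enc g ≤ k}.Finite := (Set.finite_Iic k).preimage henc.injOn
    obtain ⟨F, hF, h⟩ := hQ hfin.toFinset (1 / (k + 1)) (by positivity)
    exact ⟨F, hF, fun g hg => by simpa using h g (by simpa using hg)⟩
  choose F hF hFol using hS
  let e : ∀ k, Fin (F k).card ≃ F k := fun k => (F k).equivFin.symm
  have hσ : ∀ k g, ∃ σ : Equiv.Perm (Fin (F k).card), ∀ i, g * (e k i : Q) ∈ F k →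
      (e k (σ i) : Q) = g * (e k i : Q) := by
    intro k g
    obtain ⟨σ, hσ⟩ := Finset.exists_equiv_extend_of_card_eq (α := Fin (F k).card) (t := F k)
      (by simp) (s := Finset.univ.filter fun i => g * (e k i : Q) ∈ F k)
      (f := fun i => g * (e k i : Q))
      (by
        intro x hx
        simp only [Finset.mem_image, Finset.mem_filter] at hx
        obtain ⟨i, hi, rfl⟩ := hx
        exact hi.2)
      (fun i _ j _ h => (e k).injective (Subtype.ext (mul_left_cancel h)))
    refine ⟨σ.trans (e k).symm, fun i hi => ?_⟩
    simpa using hσ i (by simpa using hi)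
  choose σ hσ using hσ
  -- the points that `g` moves out of the Følner set
  let bad : ∀ k, Q → Finset (Fin (F k).card) := fun k g => Finset.univ.filter fun i =>
    g * (e k i : Q) ∉ F k
  have hbad : ∀ k g, enc g ≤ k → ((bad k g).card : ℝ) ≤ 1 / (k + 1) * (F k).card := by
    intro k g hg
    refine le_trans ?_ (hFol k g hg)
    have : (bad k g).card ≤ ((F k).filter fun x => g * x ∉ F k).card := by
      refine Finset.card_le_card_of_injOn (fun i => (e k i : Q)) (fun i hi => ?_)
        (fun i _ j _ h => (e k).injective (Subtype.ext h))
      simp only [bad, Finset.coe_filter, Finset.mem_univ, true_and, Set.mem_ofPred_eq] at hi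
      simpa using hi
    exact_mod_cast this
  have hpos : ∀ k, (0 : ℝ) < (F k).card := fun k => by exact_mod_cast (hF k).card_pos
  refine ⟨fun k => (F k).card, fun k g => permUnitary _ (σ k g), fun k => (hF k).card_pos,
    fun g h => ?_, fun k => ?_, fun g hg => ?_⟩
  · have hlim : Tendsto (fun k : ℕ => √(2 * (2 * (1 / ((k : ℝ) + 1))))) atTop (𝓝 0) := by
      have := ((tendsto_one_div_add_atTop_nhds_zero_nat (𝕜 := ℝ)).const_mul 2).const_mul 2
      simpa using this.sqrt
    refine squeeze_zero' (Eventually.of_forall fun k => hsDist_nonneg _ _) ?_ hlim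
    filter_upwards [eventually_ge_atTop (max (enc h) (enc (g * h)))] with k hk
    rw [← map_mul, hsDist_permUnitary]
    refine Real.sqrt_le_sqrt ?_
    rw [mul_div_assoc]
    gcongr
    rw [div_le_iff₀ (hpos k)]
    have hsub : (Finset.univ.filter fun i => σ k (g * h) i ≠ (σ k g * σ k h) i) ⊆
        bad k h ∪ bad k (g * h) := by
      intro i hi
      by_contra hcon
      simp only [bad, Finset.mem_union, Finset.mem_filter, Finset.mem_univ, true_and, not_or,
        not_not] at hcon
      refine (Finset.mem_filter.1 hi).2 ((e k).injective (Subtype.ext ?_))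
      have h1 := hσ k h i hcon.1
      rw [hσ k (g * h) i hcon.2, Equiv.Perm.mul_apply, hσ k g _ (by
        rw [h1, ← mul_assoc]; exact hcon.2), h1, mul_assoc]
    have hc : ((Finset.univ.filter fun i => σ k (g * h) i ≠ (σ k g * σ k h) i).card : ℝ) ≤
        (bad k h).card + (bad k (g * h)).card := by
      exact_mod_cast (Finset.card_le_card hsub).trans (Finset.card_union_le _ _)
    have h1 := hbad k h ((le_max_left _ _).trans hk)
    have h2 := hbad k (g * h) ((le_max_right _ _).trans hk)
    linarith
  · have : σ k 1 = 1 := by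
      ext1 i
      refine (e k).injective (Subtype.ext ?_)
      rw [hσ k 1 i (by simp)]
      simp
    exact (congrArg _ this).trans (map_one _)
  · filter_upwards [eventually_ge_atTop (max (enc g) 1)] with k hk
    rw [← map_one (permUnitary _), hsDist_permUnitary, Real.one_le_sqrt,
      one_le_div (hpos k)]
    have hsub : Finset.univ ⊆
        (Finset.univ.filter fun i => σ k g i ≠ (1 : Equiv.Perm (Fin (F k).card)) i) ∪ bad k g := by
      intro i _
      by_contra hcon
      simp only [bad, Finset.mem_union, Finset.mem_filter, Finset.mem_univ, true_and, not_or,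
        not_not, Equiv.Perm.one_apply] at hcon
      have := hσ k g i hcon.2
      rw [by_contra fun h => hcon.1 (Finset.mem_filter.2 ⟨Finset.mem_univ i, h⟩)] at this
      exact hg (by simpa using this)
    have hc : ((F k).card : ℝ) ≤ ((Finset.univ.filter fun i =>
        σ k g i ≠ (1 : Equiv.Perm (Fin (F k).card)) i).card : ℝ) + (bad k g).card := by
      have := (Finset.card_le_card hsub).trans (Finset.card_union_le _ _)
      rw [Finset.card_univ, Fintype.card_fin] at this
      exact_mod_cast this
    have h1 := hbad k g ((le_max_left _ _).trans hk)
    have hk1 : (1 : ℝ) ≤ k := by exact_mod_cast (le_max_right _ _).trans hk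
    have h2 : 1 / ((k : ℝ) + 1) * (F k).card ≤ 1 / 2 * (F k).card := by
      gcongr
      linarith
    linarith

/-! ### Central commutators in finite-dimensional representations -/

/-- If `C = W U W⁻¹ U⁻¹` commutes with `U` and `W`, then `W` permutes the eigenspaces of `U` within
an eigenspace of `C`, multiplying eigenvalues by the eigenvalue `c` of `C`. So `c` is a root of
unity of order at most the dimension. -/
theorem eigenvalue_pow_factorial_eq_one {V : Type*} [AddCommGroup V] [Module ℂ V]
    [FiniteDimensional ℂ V] (C U W : Module.End ℂ V) (hC : Function.Injective C)
    (hU : Function.Injective U) (hW : Function.Injective W) (hCU : Commute C U)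
    (hCW : Commute C W) (h : W * U = C * U * W) (c : ℂ) (hc : C.HasEigenvalue c) :
    c ^ (Module.finrank ℂ V).factorial = 1 := by
  have hmap : Set.MapsTo U (C.eigenspace c) (C.eigenspace c) :=
    Module.End.mapsTo_genEigenspace_of_comm hCU c 1
  have hnt : Nontrivial (C.eigenspace c) := Submodule.nontrivial_iff_ne_bot.2 hc
  obtain ⟨μ, hμ⟩ := Module.End.exists_eigenvalue (U.restrict hmap)
  obtain ⟨⟨x, hxc⟩, hx⟩ := hμ.exists_hasEigenvector
  have hx0 : x ≠ 0 := fun h0 => hx.2 (Subtype.ext h0)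
  have hUx : U x = μ • x := congrArg Subtype.val (Module.End.mem_eigenspace_iff.1 hx.1)
  have hCx : C x = c • x := Module.End.mem_eigenspace_iff.1 hxc
  have hc0 : c ≠ 0 := fun h0 => hx0 (hC (by rw [hCx, h0, zero_smul, map_zero]))
  have hμ0 : μ ≠ 0 := fun h0 => hx0 (hU (by rw [hUx, h0, zero_smul, map_zero]))
  have key : ∀ i : ℕ, C ((W ^ i) x) = c • (W ^ i) x ∧
      U ((W ^ i) x) = (μ * (c⁻¹) ^ i) • (W ^ i) x ∧ (W ^ i) x ≠ 0 := by
    intro i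
    induction i with
    | zero => simpa using ⟨hCx, hUx, hx0⟩
    | succ i ih =>
      obtain ⟨h1, h2, h3⟩ := ih
      have e1 : C (W ((W ^ i) x)) = c • W ((W ^ i) x) := by
        rw [← Module.End.mul_apply, hCW.eq, Module.End.mul_apply, h1, map_smul]
      rw [pow_succ', Module.End.mul_apply]
      refine ⟨e1, ?_, fun h0 => h3 (hW (by rw [h0, map_zero]))⟩
      have e2 := LinearMap.congr_fun h ((W ^ i) x)
      simp only [Module.End.mul_apply] at e2
      rw [h2, map_smul] at e2
      rw [← Module.End.mul_apply C U, hCU.eq, Module.End.mul_apply, e1, map_smul] at e2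
      rw [pow_succ, ← mul_assoc, mul_comm, mul_smul, e2, smul_smul, inv_mul_cancel₀ hc0, one_smul]
  set n := Module.finrank ℂ V
  by_contra hcon
  have hinj : Function.Injective fun i : Fin (n + 1) => μ * (c⁻¹) ^ (i : ℕ) := by
    have hlt : ∀ i j : Fin (n + 1), i < j → μ * (c⁻¹) ^ (i : ℕ) ≠ μ * (c⁻¹) ^ (j : ℕ) := by
      intro i j hij he
      have h1 := mul_left_cancel₀ hμ0 he
      have hij' : (i : ℕ) < j := hij
      have h2 : c ^ ((j : ℕ) - i) = 1 := by
        rw [inv_pow, inv_pow, inv_inj] at h1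
        have : c ^ ((j : ℕ) - i) * c ^ (i : ℕ) = c ^ (j : ℕ) := by
          rw [← pow_add, Nat.sub_add_cancel hij'.le]
        rw [← h1] at this
        exact mul_right_cancel₀ (pow_ne_zero _ hc0) (by rw [this, one_mul])
      obtain ⟨m, hm⟩ : (j : ℕ) - i ∣ n.factorial :=
        Nat.dvd_factorial (by omega) (by omega)
      exact hcon (by rw [hm, pow_mul, h2, one_pow])
    intro i j he
    rcases lt_trichotomy i j with hij | hij | hij
    · exact absurd he (hlt i j hij)
    · exact hij
    · exact absurd he.symm (hlt j i hij)
  have hli := Module.End.eigenvectors_linearIndependent' U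
    (fun i : Fin (n + 1) => μ * (c⁻¹) ^ (i : ℕ)) hinj (fun i => (W ^ (i : ℕ)) x)
    fun i => ⟨Module.End.mem_eigenspace_iff.2 (key i).2.1, (key i).2.2⟩
  have := hli.fintype_card_le_finrank
  simp [n] at this

/-- A unitary matrix is diagonalizable, so it has finite order if its eigenvalues do. -/
theorem unitary_pow_eq_one_of_eigenvalues {n : ℕ} (C : Matrix.unitaryGroup (Fin n) ℂ) (N : ℕ)
    (h : ∀ c ∈ spectrum ℂ (C : Matrix (Fin n) (Fin n) ℂ), c ^ N = 1) : C ^ N = 1 := by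
  open scoped Matrix.Norms.L2Operator in
  have hn : IsStarNormal (C : Matrix (Fin n) (Fin n) ℂ) :=
    ⟨(Matrix.mem_unitaryGroup_iff'.1 C.2).trans (Matrix.mem_unitaryGroup_iff.1 C.2).symm⟩
  have h1 := cfc_pow_id (R := ℂ) (p := IsStarNormal) (C : Matrix (Fin n) (Fin n) ℂ) N
  have h2 := cfc_congr (p := IsStarNormal) (R := ℂ) (a := (C : Matrix (Fin n) (Fin n) ℂ))
    (f := fun x => x ^ N) (g := fun _ => 1) h
  rw [h1, cfc_const_one ℂ _] at h2
  exact Subtype.ext h2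

/-- A commutator of unitary `n × n` matrices that commutes with both of them has order dividing
`n!`. -/
theorem unitary_central_commutator_pow_factorial {n : ℕ} (C U W : Matrix.unitaryGroup (Fin n) ℂ)
    (hCU : Commute C U) (hCW : Commute C W) (h : W * U = C * U * W) : C ^ n.factorial = 1 := by
  refine unitary_pow_eq_one_of_eigenvalues C _ fun c hc => ?_
  let φ := Matrix.toLinAlgEquiv' (R := ℂ) (n := Fin n)
  have hinj : ∀ A : Matrix.unitaryGroup (Fin n) ℂ, Function.Injective (φ A) := by
    intro A
    refine Function.LeftInverse.injective (g := φ (A⁻¹ : Matrix.unitaryGroup (Fin n) ℂ)) fun x => ?_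
    rw [← Module.End.mul_apply, ← map_mul, ← Matrix.UnitaryGroup.mul_val, inv_mul_cancel]
    simp
  have := eigenvalue_pow_factorial_eq_one (φ C) (φ U) (φ W) (hinj C) (hinj U) (hinj W) ?_ ?_ ?_ c ?_
  · simpa using this
  · rw [commute_iff_eq, ← map_mul, ← map_mul, ← Matrix.UnitaryGroup.mul_val, hCU.eq,
      Matrix.UnitaryGroup.mul_val]
  · rw [commute_iff_eq, ← map_mul, ← map_mul, ← Matrix.UnitaryGroup.mul_val, hCW.eq,
      Matrix.UnitaryGroup.mul_val]
  · simp only [← map_mul, ← Matrix.UnitaryGroup.mul_val, h]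
  · rw [Module.End.hasEigenvalue_iff_mem_spectrum]
    rwa [AlgEquiv.spectrum_eq]

/-- Let `z j` be the commutator of `W` and `u j`, commuting with both, and let `z (j + 1)` be a
`p`-th root of `z j`. All `z j` have orders dividing `n!`, hence orders prime to `p` since they have
`p ^ r`-th roots among themselves; so `z 1` is a power of `z 0`. As `W` conjugates `u 0` to
`z 0 * u 0`, the elements `z 0 ^ j * u 0` are all equally far from `1`, and `z 1` is close to `1` as
soon as `u 0` is. -/
theorem hsDist_central_root_le {n p : ℕ} (hp : p.Prime) (u : ℕ → Matrix.unitaryGroup (Fin n) ℂ)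
    (W : Matrix.unitaryGroup (Fin n) ℂ) (z : ℕ → Matrix.unitaryGroup (Fin n) ℂ)
    (hzp : ∀ j, z (j + 1) ^ p = z j) (hzu : ∀ j, Commute (z j) (u j))
    (hzW : ∀ j, Commute (z j) W) (h : ∀ j, W * u j = z j * u j * W) :
    hsDist (z 1) 1 ≤ 2 * hsDist (u 0) 1 := by
  have hzpow : ∀ r j, z (j + r) ^ p ^ r = z j := by
    intro r
    induction r with
    | zero => simp
    | succ r ih =>
      intro j
      rw [pow_succ, mul_comm, pow_mul, ← add_assoc, hzp, ih]
  have hz : ∀ j, z j ^ n.factorial = 1 := fun j =>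
    unitary_central_commutator_pow_factorial _ _ W (hzu j) (hzW j) (h j)
  obtain ⟨r, m, hm, hN⟩ := Nat.exists_eq_pow_mul_and_not_dvd n.factorial_ne_zero p hp.ne_one
  have hz1 : z 1 ^ m = 1 := by
    rw [← hzpow r 1, ← pow_mul, ← hN, hz]
  have hcop : Nat.Coprime p m := (Nat.Prime.coprime_iff_not_dvd hp).2 hm
  obtain ⟨l, hl⟩ : ∃ l : ℤ, z 1 = z 0 ^ l := by
    refine ⟨Nat.gcdA p m, ?_⟩
    have h1 := Nat.gcd_eq_gcd_ab p m
    rw [hcop.gcd_eq_one] at h1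
    rw [← hzp 0, zero_add, ← zpow_natCast, ← zpow_mul]
    calc z 1 = z 1 ^ ((1 : ℕ) : ℤ) := by simp
      _ = _ := by rw [h1, zpow_add, zpow_mul (z 1) m, zpow_natCast (z 1) m, hz1, one_zpow, mul_one]
  have hconj : W * u 0 * W⁻¹ = z 0 * u 0 := by rw [h 0, mul_inv_cancel_right]
  -- conjugation by `W` multiplies by `z 0` without changing the distance to `1`
  have hshift : ∀ j : ℤ, hsDist (z 0 ^ j * u 0) 1 = hsDist (u 0) 1 := by
    have hstep : ∀ j : ℤ, hsDist (z 0 ^ (j + 1) * u 0) 1 = hsDist (z 0 ^ j * u 0) 1 := by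
      intro j
      have : z 0 ^ (j + 1) * u 0 = W * (z 0 ^ j * u 0) * W⁻¹ := by
        rw [zpow_add_one, mul_assoc, ← hconj, ← mul_assoc, ← mul_assoc, ← mul_assoc,
          ((hzW 0).zpow_left j).eq]
      rw [this]
      nth_rw 1 [← mul_inv_cancel W]
      rw [hsDist_mul_right]
      nth_rw 2 [← mul_one W]
      rw [hsDist_mul_left]
    intro j
    induction j using Int.induction_on with
    | zero => simp
    | succ i ih => rw [hstep, ih]
    | pred i ih => rw [← ih, ← hstep (-i - 1), sub_add_cancel]
  have h1 : hsDist (z 0 ^ l) (u 0)⁻¹ = hsDist (u 0) 1 := by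
    rw [← hsDist_mul_right _ _ (u 0), inv_mul_cancel, hshift]
  have h2 : hsDist (u 0)⁻¹ 1 = hsDist (u 0) 1 := by
    rw [← hsDist_mul_right _ _ (u 0), inv_mul_cancel, one_mul, hsDist_comm]
  rw [hl]
  linarith [hsDist_triangle (z 0 ^ l) (u 0)⁻¹ 1]

/-! ### The obstruction to stability -/

theorem IsHSStable.isLocallyHSStable {G : Type*} [Group G] (h : IsHSStable G) :
    IsLocallyHSStable G := by
  intro n π hn hπ
  obtain ⟨σ, hσ⟩ := h n π hn hπ
  exact ⟨fun k g => σ k g, fun g h => Eventually.of_forall fun k => map_mul _ _ _, hσ⟩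

/-- A locally multiplicative sequence of maps agrees eventually, on each word, with the
homomorphism from the free group that it induces. -/
theorem eventually_lift_eq {G α : Type*} [Group G] {H : ℕ → Type*} [∀ k, Group (H k)]
    (σ : ∀ k, G → H k) (hσ : ∀ g h : G, ∀ᶠ k in atTop, σ k (g * h) = σ k g * σ k h)
    (f : FreeGroup α →* G) (x : FreeGroup α) :
    ∀ᶠ k in atTop, FreeGroup.lift (fun i => σ k (f (FreeGroup.of i))) x = σ k (f x) := by
  have hone : ∀ᶠ k in atTop, σ k 1 = 1 := by
    filter_upwards [hσ 1 1] with k hk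
    simpa using hk
  induction x using FreeGroup.induction_on with
  | C1 => filter_upwards [hone] with k hk; simp [hk]
  | of i => simp
  | inv_of i ih =>
    filter_upwards [hone, hσ (f (FreeGroup.of i))⁻¹ (f (FreeGroup.of i))] with k h1 h2
    rw [inv_mul_cancel, h1] at h2
    simp [eq_inv_of_mul_eq_one_left h2.symm]
  | mul x y hx hy =>
    filter_upwards [hx, hy, hσ (f x) (f y)] with k h1 h2 h3
    rw [map_mul, map_mul, h1, h2, h3]

/-- The obstruction to local stability. The approximate representations come from an amenable
quotient that kills `u 0` but not the central element `z 1`; in an honest finite-dimensional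
representation `z 1` is at most twice as far from `1` as `u 0` is. -/
theorem not_isLocallyHSStable_of_central_roots {G Q : Type*} [Group G] [Group Q] [Countable Q]
    [Group.IsFinitelyPresented G] {p : ℕ} (hp : p.Prime) (u z : ℕ → G) (W : G)
    (hzp : ∀ j, z (j + 1) ^ p = z j) (hzu : ∀ j, Commute (z j) (u j)) (hzW : ∀ j, Commute (z j) W)
    (h : ∀ j, W * u j = z j * u j * W) (hQ : HasFoelnerSets Q) (φ : G →* Q) (hu : φ (u 0) = 1)
    (hz : φ (z 1) ≠ 1) : ¬ IsLocallyHSStable G := by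
  intro hstab
  obtain ⟨n, π, hn, hπ, hπ1, hπz⟩ := hQ.exists_isHSAsymptoticHom
  obtain ⟨σ, hσ, hσπ⟩ := hstab n (fun k g => π k (φ g)) hn
    (fun g g' => by simpa using hπ (φ g) (φ g'))
  obtain ⟨m, f, hf, S, hS, hker⟩ := Group.IsFinitelyPresented.out (G := G)
  choose t ht using hf
  let L : ∀ k, FreeGroup (Fin m) →* Matrix.unitaryGroup (Fin (n k)) ℂ :=
    fun k => FreeGroup.lift fun i => σ k (f (FreeGroup.of i))
  have hL : ∀ x, ∀ᶠ k in atTop, L k x = σ k (f x) := eventually_lift_eq σ hσ f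
  have hone : ∀ᶠ k in atTop, σ k 1 = 1 := by
    filter_upwards [hσ 1 1] with k hk
    simpa using hk
  have hrel : ∀ᶠ k in atTop, ∀ s ∈ S, L k s = 1 := by
    refine (eventually_all_finite hS).2 fun s hs => ?_
    have hfs : f s = 1 := by
      rw [← MonoidHom.mem_ker, ← hker]
      exact Subgroup.subset_normalClosure hs
    filter_upwards [hL s, hone] with k h1 h2
    rw [h1, hfs, h2]
  have hle : ∀ᶠ k in atTop, ∀ x y, f x = f y → L k x = L k y := by
    filter_upwards [hrel] with k hk x y hxy
    have hk' : f.ker ≤ (L k).ker := by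
      rw [← hker]
      exact Subgroup.normalClosure_le_normal hk
    have hmem : x * y⁻¹ ∈ f.ker := by simp [MonoidHom.mem_ker, hxy]
    have := hk' hmem
    rw [MonoidHom.mem_ker, map_mul, map_inv, mul_inv_eq_one] at this
    exact this
  have hbound : ∀ᶠ k in atTop, hsDist (σ k (z 1)) 1 ≤ 2 * hsDist (σ k (u 0)) 1 := by
    filter_upwards [hle, hL (t (z 1)), hL (t (u 0))] with k hk h1 h2
    rw [ht] at h1 h2
    rw [← h1, ← h2]
    refine hsDist_central_root_le hp (fun j => L k (t (u j))) (L k (t W)) (fun j => L k (t (z j)))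
      (fun j => ?_) (fun j => ?_) (fun j => ?_) (fun j => ?_)
    · rw [← map_pow]
      exact hk _ _ (by rw [map_pow, ht, ht, hzp])
    · rw [commute_iff_eq, ← map_mul, ← map_mul]
      exact hk _ _ (by simp only [map_mul, ht, (hzu j).eq])
    · rw [commute_iff_eq, ← map_mul, ← map_mul]
      exact hk _ _ (by simp only [map_mul, ht, (hzW j).eq])
    · simp only [← map_mul]
      exact hk _ _ (by simp only [map_mul, ht, h j])
  have hu0 : Tendsto (fun k => hsDist (σ k (u 0)) 1) atTop (𝓝 0) := by
    simpa [hu, hπ1] using hσπ (u 0)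
  have hz1 := hσπ (z 1)
  obtain ⟨k, h1, h2, h3, h4⟩ := (hbound.and ((hu0.eventually (gt_mem_nhds
    (show (0 : ℝ) < 1 / 4 by norm_num))).and ((hz1.eventually (gt_mem_nhds
    (show (0 : ℝ) < 1 / 4 by norm_num))).and (hπz _ hz)))).exists
  have h5 := hsDist_triangle (π k (φ (z 1))) (σ k (z 1)) 1
  rw [hsDist_comm _ (σ k (z 1))] at h5
  linarith

/-! ### One-parameter subgroups over `ℤ[1/p]` -/

/-- The power `p ^ n`, for an integer `n`, as an element of `ℤ[1/p]`. -/
def zPow (p : Nat.Primes) (n : ℤ) : zInvP p := ⟨(p : ℚ) ^ n, zpow_mem_zInvP p n⟩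

theorem zPow_zero (p : Nat.Primes) : zPow p 0 = 1 := Subtype.ext (by simp [zPow])

theorem zPow_add (p : Nat.Primes) (m n : ℤ) : zPow p (m + n) = zPow p m * zPow p n :=
  Subtype.ext (zpow_add₀ (by exact_mod_cast p.2.ne_zero) m n)

/-- A property of pairs in `ℤ[1/p]` that holds for integers and can be divided by `p`
simultaneously in both arguments holds for all pairs. -/
theorem zInvP_induction₂ {p : Nat.Primes} (P : zInvP p → zInvP p → Prop)
    (hint : ∀ i j : ℤ, P i j) (hs : ∀ x y, P (zPow p 1 * x) (zPow p 1 * y) → P x y)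
    (x y : zInvP p) : P x y := by
  have hp : (p : ℚ) ≠ 0 := by exact_mod_cast p.2.ne_zero
  have hN : ∀ (N : ℕ) x y, P (zPow p N * x) (zPow p N * y) → P x y := by
    intro N
    induction N with
    | zero => intro x y h; simpa [zPow_zero] using h
    | succ N ih =>
      intro x y h
      refine hs _ _ (ih _ _ ?_)
      rwa [← mul_assoc, ← mul_assoc, ← zPow_add]
  obtain ⟨a, n, hx⟩ := x.2
  obtain ⟨b, m, hy⟩ := y.2
  refine hN (n + m) x y ?_
  have h1 : zPow p ((n + m : ℕ) : ℤ) * x = ((a * p ^ m : ℤ) : zInvP p) := by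
    refine Subtype.ext ?_
    simp only [zPow, Subring.coe_mul, hx]
    push_cast
    rw [zpow_add₀ hp, zpow_natCast, zpow_natCast]
    field_simp
  have h2 : zPow p ((n + m : ℕ) : ℤ) * y = ((b * p ^ n : ℤ) : zInvP p) := by
    refine Subtype.ext ?_
    simp only [zPow, Subring.coe_mul, hy]
    push_cast
    rw [zpow_add₀ hp, zpow_natCast, zpow_natCast]
    field_simp
  push_cast at h1 h2
  have := hint (a * p ^ m) (b * p ^ n)
  push_cast at this
  rwa [← h1, ← h2] at this

theorem zInvP_induction {p : Nat.Primes} (P : zInvP p → Prop) (hint : ∀ i : ℤ, P i)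
    (hs : ∀ x, P (zPow p 1 * x) → P x) (x : zInvP p) : P x :=
  zInvP_induction₂ (fun x _ => P x) (fun i _ => hint i) (fun x _ => hs x) x x

/-- A one-parameter subgroup: a homomorphism from the additive group `ℤ[1/p]` to a group, written
as a plain function. -/
structure OneParam (p : Nat.Primes) (H : Type*) [Group H] where
  /-- The underlying function. -/
  toFun : zInvP p → H
  map_add' : ∀ x y, toFun (x + y) = toFun x * toFun y

namespace OneParam

variable {p : Nat.Primes} {H : Type*} [Group H]

instance : CoeFun (OneParam p H) fun _ => zInvP p → H := ⟨toFun⟩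

theorem map_add (e : OneParam p H) (x y : zInvP p) : e (x + y) = e x * e y := e.map_add' x y

theorem map_zero (e : OneParam p H) : e 0 = 1 := by
  have := e.map_add 0 0
  simpa using this

theorem map_neg (e : OneParam p H) (x : zInvP p) : e (-x) = (e x)⁻¹ := by
  rw [eq_inv_iff_mul_eq_one, ← map_add, neg_add_cancel, map_zero]

theorem map_intCast (e : OneParam p H) (i : ℤ) : e i = e 1 ^ i := by
  induction i using Int.induction_on with
  | zero => simp [map_zero]
  | succ i ih => rw [Int.cast_add, map_add, ih, zpow_add_one, Int.cast_one]
  | pred i ih => rw [Int.cast_sub, sub_eq_add_neg, map_add, ih, zpow_sub_one, Int.cast_one, map_neg]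

/-- The image of a one-parameter subgroup under a homomorphism. -/
def map {H' : Type*} [Group H'] (e : OneParam p H) (f : H →* H') : OneParam p H' where
  toFun x := f (e x)
  map_add' x y := by rw [map_add, _root_.map_mul]

/-- Conjugation by `T` acts on the one-parameter subgroup `e` as multiplication by `p ^ i`. -/
def HasWeight (T : H) (i : ℤ) (e : OneParam p H) : Prop :=
  ∀ x, T * e x * T⁻¹ = e (zPow p i * x)

/-- Any two values of the one-parameter subgroups `e` and `f` commute. -/
def Comm (e f : OneParam p H) : Prop := ∀ x y, Commute (e x) (f y)

/-- The commutator of `e x` and `f y` is `g (x * y)`. -/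
def Heis (e f g : OneParam p H) : Prop := ∀ x y, e x * f y = g (x * y) * f y * e x

theorem Comm.symm {e f : OneParam p H} (h : Comm e f) : Comm f e := fun x y => (h y x).symm

theorem HasWeight.mul {S T : H} {i j : ℤ} {e : OneParam p H} (hS : HasWeight S i e)
    (hT : HasWeight T j e) : HasWeight (S * T) (i + j) e := by
  intro x
  rw [zPow_add, mul_assoc (zPow p i), ← hS, ← hT]
  group

theorem HasWeight.inv {T : H} {i : ℤ} {e : OneParam p H} (hT : HasWeight T i e) :
    HasWeight T⁻¹ (-i) e := by
  intro x
  have := hT (zPow p (-i) * x)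
  rw [← mul_assoc (zPow p i), ← zPow_add, add_neg_cancel, zPow_zero, one_mul] at this
  rw [← this]
  group

theorem hasWeight_zero {T : H} {e : OneParam p H} (h : ∀ x, Commute T (e x)) :
    HasWeight T 0 e := by
  intro x
  rw [zPow_zero, one_mul, (h x).eq, mul_inv_cancel_right]

theorem HasWeight.commute {T : H} {e : OneParam p H} (h : HasWeight T 0 e) (x : zInvP p) :
    Commute T (e x) := by
  have := h x
  rwa [zPow_zero, one_mul, mul_inv_eq_iff_eq_mul] at this

theorem HasWeight.zpow {T : H} {i : ℤ} {e : OneParam p H} (hT : HasWeight T i e) (m : ℤ) :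
    HasWeight (T ^ m) (m * i) e := by
  induction m using Int.induction_on with
  | zero =>
    rw [zpow_zero, zero_mul]
    exact hasWeight_zero fun x => Commute.one_left _
  | succ m ih =>
    rw [zpow_add_one, add_mul, one_mul]
    exact ih.mul hT
  | pred m ih =>
    rw [zpow_sub_one, sub_mul, one_mul, sub_eq_add_neg]
    exact ih.mul hT.inv

theorem HasWeight.mul_left_comm {T : H} {i : ℤ} {e : OneParam p H} (hT : HasWeight T i e) (m : ℤ)
    (x : zInvP p) (y : H) : T ^ m * (e x * y) = e (zPow p (m * i) * x) * (T ^ m * y) := by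
  rw [← hT.zpow m]
  group

/-- Two one-parameter subgroups commute if their generators do and a single element conjugates
both by `p`. -/
theorem comm_of_scaling {T : H} {e f : OneParam p H} (he : HasWeight T 1 e) (hf : HasWeight T 1 f)
    (h : Commute (e 1) (f 1)) : Comm e f := by
  refine zInvP_induction₂ (fun x y => Commute (e x) (f y)) (fun i j => ?_) (fun x y hxy => ?_)
  · rw [map_intCast, map_intCast]
    exact (h.zpow_left i).zpow_right j
  · rw [← he, ← hf] at hxy
    exact (SemiconjBy.conj_iff (a := e x) (b := T) (x := f y) (y := f y)).1 hxy

/-- The commutator relation of three one-parameter subgroups follows from that of their generators.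
As the commutator is bilinear, the weight of `g` is the sum of those of `e` and `f`. -/
theorem heis_of_scaling {T : H} {e f g : OneParam p H} (he : HasWeight T 1 e)
    (hf : HasWeight T 1 f) (hg : HasWeight T 2 g) (h : e 1 * f 1 = g 1 * f 1 * e 1)
    (hge : Commute (g 1) (e 1)) (hgf : Commute (g 1) (f 1)) : Heis e f g := by
  refine zInvP_induction₂ (fun x y => e x * f y = g (x * y) * f y * e x) (fun i j => ?_)
    (fun x y hxy => ?_)
  · have h1 : ∀ i : ℤ, e 1 ^ i * f 1 * (e 1 ^ i)⁻¹ = g 1 ^ i * f 1 := by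
      have hb : e 1 * f 1 * (e 1)⁻¹ = g 1 * f 1 := by rw [h, mul_inv_cancel_right]
      have hb' : (e 1)⁻¹ * f 1 * e 1 = (g 1)⁻¹ * f 1 := by
        have h2 : f 1 * e 1 = (g 1)⁻¹ * e 1 * f 1 := by
          rw [mul_assoc, h]
          group
        rw [mul_assoc, h2, (hge.inv_left).eq]
        group
      intro i
      induction i using Int.induction_on with
      | zero => simp
      | succ i ih =>
        rw [add_comm (i : ℤ) 1, zpow_add, zpow_one, mul_inv_rev]
        calc e 1 * e 1 ^ (i : ℤ) * f 1 * ((e 1 ^ (i : ℤ))⁻¹ * (e 1)⁻¹)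
            = e 1 * (e 1 ^ (i : ℤ) * f 1 * (e 1 ^ (i : ℤ))⁻¹) * (e 1)⁻¹ := by group
          _ = e 1 * g 1 ^ (i : ℤ) * f 1 * (e 1)⁻¹ := by rw [ih]; group
          _ = g 1 ^ (i : ℤ) * (e 1 * f 1 * (e 1)⁻¹) := by
            rw [← (hge.zpow_left (i : ℤ)).eq]; group
          _ = g 1 ^ (1 + (i : ℤ)) * f 1 := by rw [hb]; group
          _ = _ := by rw [zpow_add, zpow_one]
      | pred i ih =>
        rw [sub_eq_add_neg, add_comm, zpow_add, zpow_neg_one, mul_inv_rev, inv_inv]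
        calc (e 1)⁻¹ * e 1 ^ (-i : ℤ) * f 1 * ((e 1 ^ (-i : ℤ))⁻¹ * e 1)
            = (e 1)⁻¹ * (e 1 ^ (-i : ℤ) * f 1 * (e 1 ^ (-i : ℤ))⁻¹) * e 1 := by group
          _ = (e 1)⁻¹ * g 1 ^ (-i : ℤ) * f 1 * e 1 := by rw [ih]; group
          _ = g 1 ^ (-i : ℤ) * ((e 1)⁻¹ * f 1 * e 1) := by
            rw [← ((hge.zpow_left (-i : ℤ)).inv_right).eq]; group
          _ = g 1 ^ (-1 + (-i : ℤ)) * f 1 := by rw [hb']; group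
          _ = _ := by rw [zpow_add, zpow_neg_one]
    rw [← Int.cast_mul, map_intCast, map_intCast, map_intCast]
    have h2 : e 1 ^ i * f 1 ^ j * (e 1 ^ i)⁻¹ = (g 1 ^ i) ^ j * f 1 ^ j := by
      rw [← conj_zpow, h1, (hgf.zpow_left i).mul_zpow]
    rw [zpow_mul, ← h2, inv_mul_cancel_right]
  · have hxy' : zPow p 1 * x * (zPow p 1 * y) = zPow p 2 * (x * y) := by
      rw [show (2 : ℤ) = 1 + 1 by norm_num, zPow_add]
      ring
    rw [hxy', ← he, ← hf, ← hg] at hxy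
    have h3 : T * (e x * f y) * T⁻¹ = T * (g (x * y) * f y * e x) * T⁻¹ := by
      calc _ = T * e x * T⁻¹ * (T * f y * T⁻¹) := by group
        _ = _ := by rw [hxy]; group
    exact mul_left_cancel (mul_right_cancel h3)

/-- The Baumslag–Solitar relation `T x T⁻¹ = x ^ p` extends `x` to a one-parameter subgroup,
`a / p ^ n ↦ T⁻ⁿ x ^ a Tⁿ`. -/
theorem exists_of_conj_eq_pow (T x : H) (h : T * x * T⁻¹ = x ^ (p : ℕ)) :
    ∃ e : OneParam p H, e 1 = x ∧ HasWeight T 1 e ∧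
      ∀ y, Commute y T → Commute y x → ∀ r, Commute y (e r) := by
  have hp : (p : ℚ) ≠ 0 := by exact_mod_cast p.2.ne_zero
  let v : ℤ → ℕ → H := fun a n => (T ^ n)⁻¹ * x ^ a * T ^ n
  have hT : ∀ (k : ℕ) (a : ℤ), T ^ k * x ^ a * (T ^ k)⁻¹ = x ^ (a * (p : ℤ) ^ k) := by
    intro k
    induction k with
    | zero => simp
    | succ k ih =>
      intro a
      calc T ^ (k + 1) * x ^ a * (T ^ (k + 1))⁻¹ = T ^ k * (T * x ^ a * T⁻¹) * (T ^ k)⁻¹ := by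
            rw [pow_succ]; group
        _ = T ^ k * x ^ (a * p) * (T ^ k)⁻¹ := by
            rw [← conj_zpow, h, ← zpow_natCast x, ← zpow_mul, mul_comm a]
        _ = _ := by rw [ih, pow_succ', mul_assoc]
  have hvk : ∀ a n k, v (a * (p : ℤ) ^ k) (n + k) = v a n := by
    intro a n k
    simp only [v]
    rw [← hT, add_comm, pow_add]
    group
  have hv : ∀ (a : ℤ) (n : ℕ) (b : ℤ) (m : ℕ), (a / (p : ℚ) ^ n) =
      b / (p : ℚ) ^ m → v a n = v b m := by
    intro a n b m hab
    have hab' : a * (p : ℤ) ^ m = b * (p : ℤ) ^ n := by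
      rw [div_eq_div_iff (pow_ne_zero _ hp) (pow_ne_zero _ hp)] at hab
      exact_mod_cast hab
    rw [← hvk a n m, ← hvk b m n, hab', add_comm]
  choose a n han using fun r : zInvP p => r.2
  have hval : ∀ (r : zInvP p) (b : ℤ) (m : ℕ), (r : ℚ) = b / (p : ℚ) ^ m → v (a r) (n r) = v b m :=
    fun r b m hr => hv _ _ _ _ ((han r).symm.trans hr)
  refine ⟨⟨fun r => v (a r) (n r), fun r s => ?_⟩, ?_, fun r => ?_, fun y hyT hyx r => ?_⟩
  · have hr : (r : ℚ) = (a r * (p : ℤ) ^ n s : ℤ) / (p : ℚ) ^ (n r + n s) := by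
      rw [han r]
      push_cast
      rw [pow_add]
      field_simp
    have hs : (s : ℚ) = (a s * (p : ℤ) ^ n r : ℤ) / (p : ℚ) ^ (n r + n s) := by
      rw [han s]
      push_cast
      rw [pow_add]
      field_simp
    rw [hval r _ _ hr, hval s _ _ hs, hval (r + s) (a r * (p : ℤ) ^ n s + a s * (p : ℤ) ^ n r)
      (n r + n s) (by rw [Subring.coe_add, hr, hs]; push_cast; ring)]
    simp only [v, zpow_add]
    group
  · change v (a 1) (n 1) = x
    rw [hval 1 1 0 (by simp)]
    simp [v]
  · change T * v (a r) (n r) * T⁻¹ = v (a _) (n _)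
    rw [hval (zPow p 1 * r) (a r * p) (n r) (by
      rw [Subring.coe_mul, han r]; simp only [zPow, zpow_one]; push_cast; ring)]
    have : x ^ (a r * (p : ℤ)) = T * x ^ (a r) * T⁻¹ := by
      have := hT 1 (a r)
      simpa using this.symm
    simp only [v]
    rw [this]
    group
  · exact (((hyT.pow_right _).inv_right).mul_right (hyx.zpow_right _)).mul_right (hyT.pow_right _)

/-- A one-parameter subgroup is determined by its generator and an element scaling it by `p`. -/
theorem ext_of_hasWeight {T : H} {e f : OneParam p H} (he : HasWeight T 1 e)
    (hf : HasWeight T 1 f) (h : e 1 = f 1) (x : zInvP p) : e x = f x := by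
  refine zInvP_induction (fun x => e x = f x) (fun i => ?_) (fun x hx => ?_) x
  · rw [map_intCast, map_intCast, h]
  · rw [← he, ← hf] at hx
    exact mul_left_cancel (mul_right_cancel hx)

end OneParam

open OneParam

/-! ### The opposite roots -/

/-- The commutation relations among the one-parameter subgroups at the positions `(1, 2)`,
`(1, 3)`, `(2, 3)`, `(2, c)`, `(3, c)` of a column `c`. They concern pairs of roots whose weights
under the torus are not opposite to each other. -/
structure AbelsColumn {p : Nat.Primes} {H : Type*} [Group H] (t s : H)
    (e12 e13 e23 e2 e3 : OneParam p H) : Prop where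
  h12_13 : Comm e12 e13
  h12_23 : Heis e12 e23 e13
  h13_23 : Comm e13 e23
  h12_3 : Comm e12 e3
  h13_2 : Comm e13 e2
  h23_3 : Heis e23 e3 e2
  h2_3 : Comm e2 e3
  t13 : HasWeight t 0 e13
  t3 : HasWeight t 0 e3
  s12 : HasWeight s 0 e12
  s2 : HasWeight s 0 e2

namespace AbelsColumn

variable {p : Nat.Primes} {H : Type*} [Group H] {t s : H} {e12 e13 e23 e2 e3 : OneParam p H}

/-- The Hall–Witt identity for `e12 x`, `e23 y`, `e3 z`. The variable `y` can be shifted from one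
side to the other, so both commutators depend on the product of their arguments only. -/
theorem commutator_eq (h : AbelsColumn t s e12 e13 e23 e2 e3) (x y z : zInvP p) :
    e12 x * e2 (y * z) * (e12 x)⁻¹ * (e2 (y * z))⁻¹ =
      e13 (x * y) * e3 z * (e13 (x * y))⁻¹ * (e3 z)⁻¹ := by
  have hXY := h.h12_23 x y
  have hYZ := h.h23_3 y z
  have hXZ := (h.h12_3 x z).eq
  have hAY := (h.h13_23 (x * y) y).eq
  have hAB := (h.h13_2 (x * y) (y * z)).eq
  have hBZ := (h.h2_3 (y * z) z).eq
  generalize e12 x = X at *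
  generalize e23 y = Y at *
  generalize e3 z = Z at *
  generalize e13 (x * y) = A at *
  generalize e2 (y * z) = B at *
  have h1 : X * B * Z * Y = A * B * Z * Y * X := by
    calc X * B * Z * Y = X * (B * Z * Y) := by group
      _ = X * Y * Z := by rw [← hYZ]; group
      _ = A * Y * (X * Z) := by rw [hXY]; group
      _ = A * (Y * Z) * X := by rw [hXZ]; group
      _ = _ := by rw [hYZ]; group
  have h2 : X * B * X⁻¹ * Z * A = A * B * Z := by
    have h3 : A * B * Z * Y * X = X * B * X⁻¹ * Z * A * Y * X := by
      calc A * B * Z * Y * X = X * B * Z * Y := h1.symm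
        _ = X * B * X⁻¹ * (X * Z) * Y := by group
        _ = X * B * X⁻¹ * Z * (X * Y) := by rw [hXZ]; group
        _ = _ := by rw [hXY]; group
    exact (mul_right_cancel (mul_right_cancel h3)).symm
  have h4 : X * B * X⁻¹ = A * B * Z * A⁻¹ * Z⁻¹ := by
    rw [← h2]
    group
  rw [h4]
  calc A * B * Z * A⁻¹ * Z⁻¹ * B⁻¹ = A * (B * Z) * A⁻¹ * (B * Z)⁻¹ := by group
    _ = A * Z * (B * A⁻¹ * B⁻¹) * Z⁻¹ := by rw [hBZ]; group
    _ = _ := by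
      have : B * A⁻¹ = A⁻¹ * B := by
        rw [eq_inv_mul_iff_mul_eq, ← mul_assoc, hAB, mul_inv_cancel_right]
      rw [this]
      group

/-- The one-parameter subgroup at position `(1, c)`. Its weight is zero, so that it has to be
constructed as a commutator. -/
theorem exists_corner (h : AbelsColumn t s e12 e13 e23 e2 e3) :
    ∃ e : OneParam p H, Heis e12 e2 e ∧
      (∀ y r, (∀ r, Commute y (e12 r)) → (∀ r, Commute y (e2 r)) → Commute y (e r)) ∧
      (∀ y r, (∀ r, Commute y (e13 r)) → (∀ r, Commute y (e3 r)) → Commute y (e r)) ∧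
      Comm e e12 ∧ Comm e e13 ∧ Comm e e2 ∧ Comm e e3 ∧ Comm e e23 ∧
      HasWeight t 0 e ∧ HasWeight s 0 e := by
  set g : zInvP p → H := fun r => e13 r * e3 1 * (e13 r)⁻¹ * (e3 1)⁻¹ with hg
  have hf : ∀ x u, e12 x * e2 u * (e12 x)⁻¹ * (e2 u)⁻¹ = g (x * u) := by
    intro x u
    have := h.commutator_eq x u 1
    rwa [mul_one] at this
  have hgf : ∀ r, g r = e12 r * e2 1 * (e12 r)⁻¹ * (e2 1)⁻¹ := fun r => by rw [hf, mul_one]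
  have hcomm : ∀ {y a b : H}, Commute y a → Commute y b → Commute y (a * b * a⁻¹ * b⁻¹) :=
    fun h1 h2 => ((h1.mul_right h2).mul_right h1.inv_right).mul_right h2.inv_right
  have c1 : ∀ y r, (∀ r, Commute y (e12 r)) → (∀ r, Commute y (e2 r)) → Commute y (g r) :=
    fun y r h1 h2 => by rw [hgf]; exact hcomm (h1 r) (h2 1)
  have c2 : ∀ y r, (∀ r, Commute y (e13 r)) → (∀ r, Commute y (e3 r)) → Commute y (g r) :=
    fun y r h1 h2 => hcomm (h1 r) (h2 1)
  have k12 : ∀ r x, Commute (g r) (e12 x) := fun r x =>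
    (c2 _ _ (fun r => h.h12_13 x r) (fun r => h.h12_3 x r)).symm
  have k13 : ∀ r x, Commute (g r) (e13 x) := fun r x =>
    (c1 _ _ (fun r => (h.h12_13 r x).symm) (fun r => h.h13_2 x r)).symm
  have k2 : ∀ r x, Commute (g r) (e2 x) := fun r x =>
    (c2 _ _ (fun r => (h.h13_2 r x).symm) (fun r => h.h2_3 x r)).symm
  have k3 : ∀ r x, Commute (g r) (e3 x) := fun r x =>
    (c1 _ _ (fun r => (h.h12_3 r x).symm) (fun r => (h.h2_3 r x).symm)).symm
  have k23 : ∀ r x, Commute (g r) (e23 x) := by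
    intro r x
    have hYZ := h.h23_3 x 1
    have hAY := (h.h13_23 r x).eq
    have hAB := (h.h13_2 r (x * 1)).eq
    have hgB := (k2 r (x * 1)).eq
    simp only [hg] at hgB ⊢
    generalize e23 x = Y at *
    generalize e3 1 = Z at *
    generalize e13 r = A at *
    generalize e2 (x * 1) = B at *
    refine Commute.symm ?_
    have h1 : Y * Z * Y⁻¹ = B * Z := by rw [hYZ]; group
    have h2 : Y * A * Y⁻¹ = A := by rw [← hAY]; group
    rw [commute_iff_eq, ← mul_inv_eq_iff_eq_mul]
    calc Y * (A * Z * A⁻¹ * Z⁻¹) * Y⁻¹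
        = Y * A * Y⁻¹ * (Y * Z * Y⁻¹) * (Y * A * Y⁻¹)⁻¹ * (Y * Z * Y⁻¹)⁻¹ := by group
      _ = A * B * Z * A⁻¹ * Z⁻¹ * B⁻¹ := by rw [h1, h2]; group
      _ = B * (A * Z * A⁻¹ * Z⁻¹) * B⁻¹ := by rw [hAB]; group
      _ = _ := by rw [← hgB]; group
  refine ⟨⟨g, fun x y => ?_⟩, fun x u => ?_, c1, c2, k12, k13, k2, k3, k23,
    hasWeight_zero fun r => c2 _ _ h.t13.commute h.t3.commute,
    hasWeight_zero fun r => c1 _ _ h.s12.commute h.s2.commute⟩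
  · have h1 := (k12 x y).eq
    have h2 : e12 x * e2 1 * (e12 x)⁻¹ = g x * e2 1 := by rw [hgf x, inv_mul_cancel_right]
    rw [hgf (x + y), hgf y, add_comm x y, OneParam.map_add]
    calc e12 y * e12 x * e2 1 * (e12 y * e12 x)⁻¹ * (e2 1)⁻¹
        = e12 y * (e12 x * e2 1 * (e12 x)⁻¹) * (e12 y)⁻¹ * (e2 1)⁻¹ := by group
      _ = e12 y * g x * e2 1 * (e12 y)⁻¹ * (e2 1)⁻¹ := by rw [h2, ← mul_assoc]
      _ = _ := by rw [← h1]; group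
  · change e12 x * e2 u = g (x * u) * e2 u * e12 x
    rw [← hf]
    group

end AbelsColumn

/-! ### The relations, and the one-parameter subgroups they produce -/

/-- The one-parameter subgroups of a group that looks like `tildeG p`, with the torus elements `t`,
`s`, the element `w` at position `(4, 5)`, and the relations needed for collecting words into a
normal form. -/
structure Frame (p : Nat.Primes) (H : Type*) [Group H] where
  /-- The torus element `diag(1, p, 1, 1, 1)`. -/
  t : H
  /-- The torus element `diag(1, 1, p, 1, 1)`. -/
  s : H
  /-- The elementary matrix with entry `1` at position `(4, 5)`. -/
  w : H
  /-- The one-parameter subgroup at position `(1, 2)`. -/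
  e12 : OneParam p H
  /-- The one-parameter subgroup at position `(1, 3)`. -/
  e13 : OneParam p H
  /-- The one-parameter subgroup at position `(1, 4)`. -/
  e14 : OneParam p H
  /-- The one-parameter subgroup at position `(1, 5)`. -/
  e15 : OneParam p H
  /-- The one-parameter subgroup at position `(2, 3)`. -/
  e23 : OneParam p H
  /-- The one-parameter subgroup at position `(2, 4)`. -/
  e24 : OneParam p H
  /-- The one-parameter subgroup at position `(2, 5)`. -/
  e25 : OneParam p H
  /-- The one-parameter subgroup at position `(3, 4)`. -/
  e34 : OneParam p H
  /-- The one-parameter subgroup at position `(3, 5)`. -/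
  e35 : OneParam p H
  ts : Commute t s
  tw : Commute t w
  sw : Commute s w
  t12 : HasWeight t (-1) e12
  t13 : HasWeight t 0 e13
  t14 : HasWeight t 0 e14
  t15 : HasWeight t 0 e15
  t23 : HasWeight t 1 e23
  t24 : HasWeight t 1 e24
  t25 : HasWeight t 1 e25
  t34 : HasWeight t 0 e34
  t35 : HasWeight t 0 e35
  s12 : HasWeight s 0 e12
  s13 : HasWeight s (-1) e13
  s14 : HasWeight s 0 e14
  s15 : HasWeight s 0 e15
  s23 : HasWeight s (-1) e23
  s24 : HasWeight s 0 e24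
  s25 : HasWeight s 0 e25
  s34 : HasWeight s 1 e34
  s35 : HasWeight s 1 e35
  w12 : ∀ x, Commute w (e12 x)
  w13 : ∀ x, Commute w (e13 x)
  w15 : ∀ x, Commute w (e15 x)
  w23 : ∀ x, Commute w (e23 x)
  w25 : ∀ x, Commute w (e25 x)
  w35 : ∀ x, Commute w (e35 x)
  w14 : ∀ x, w * e14 x = e14 x * e15 (-x) * w
  w24 : ∀ x, w * e24 x = e24 x * e25 (-x) * w
  w34 : ∀ x, w * e34 x = e34 x * e35 (-x) * w
  h12_13 : Comm e12 e13
  h12_14 : Comm e12 e14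
  h12_15 : Comm e12 e15
  h12_23 : Heis e12 e23 e13
  h12_24 : Heis e12 e24 e14
  h12_25 : Heis e12 e25 e15
  h12_34 : Comm e12 e34
  h12_35 : Comm e12 e35
  h13_14 : Comm e13 e14
  h13_15 : Comm e13 e15
  h13_23 : Comm e13 e23
  h13_24 : Comm e13 e24
  h13_25 : Comm e13 e25
  h14_15 : Comm e14 e15
  h14_24 : Comm e14 e24
  h14_25 : Comm e14 e25
  h15_25 : Comm e15 e25
  h23_24 : Comm e23 e24
  h23_25 : Comm e23 e25
  h23_34 : Heis e23 e34 e24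
  h23_35 : Heis e23 e35 e25
  h24_25 : Comm e24 e25
  h24_34 : Comm e24 e34
  h24_35 : Comm e24 e35
  h25_35 : Comm e25 e35

/-- The relations of the finite presentation, as pairs of words in the generators
`t, s, w, e12 1, e13 1, e23 1, e24 1, e25 1, e34 1, e35 1`, evaluated in a group: the torus action,
the commutators of pairs of roots that are not opposite, and the action of `w`. -/
def tildeGRelations {H : Type*} [Group H] (p : ℕ) (g : Fin 10 → H) : List (H × H) :=
  let t := g 0
  let s := g 1
  let w := g 2
  let a12 := g 3
  let a13 := g 4
  let a23 := g 5
  let a24 := g 6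
  let a25 := g 7
  let a34 := g 8
  let a35 := g 9
  [(t * s, s * t), (t * w, w * t), (s * w, w * s),
    (t⁻¹ * a12 * t⁻¹⁻¹, a12 ^ p), (s * a12, a12 * s),
    (s⁻¹ * a13 * s⁻¹⁻¹, a13 ^ p), (t * a13, a13 * t),
    (t * a23 * t⁻¹, a23 ^ p), (t * s * a23, a23 * (t * s)),
    (t * a24 * t⁻¹, a24 ^ p), (s * a24, a24 * s),
    (t * a25 * t⁻¹, a25 ^ p), (s * a25, a25 * s),
    (s * a34 * s⁻¹, a34 ^ p), (t * a34, a34 * t),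
    (s * a35 * s⁻¹, a35 ^ p), (t * a35, a35 * t),
    (a12 * a13, a13 * a12), (a12 * a23, a13 * a23 * a12), (a13 * a23, a23 * a13),
    (a12 * a34, a34 * a12), (a12 * a35, a35 * a12),
    (a13 * a24, a24 * a13), (a13 * a25, a25 * a13),
    (a23 * a24, a24 * a23), (a23 * a25, a25 * a23),
    (a23 * a34, a24 * a34 * a23), (a23 * a35, a25 * a35 * a23),
    (a24 * a34, a34 * a24), (a25 * a35, a35 * a25), (a24 * a35, a35 * a24),
    (a25 * a34, a34 * a25), (a24 * a25, a25 * a24), (a34 * a35, a35 * a34),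
    (w * a12, a12 * w), (w * a13, a13 * w), (w * a23, a23 * w), (w * a25, a25 * w),
    (w * a35, a35 * w), (w * a24, a24 * a25⁻¹ * w), (w * a34, a34 * a35⁻¹ * w)]

/-- If `w` moves the generators of `e` by those of `f`, and commutes with an element scaling `e`
and `f`, then it does so throughout. -/
theorem OneParam.shear_of_scaling {p : Nat.Primes} {H : Type*} [Group H] {T w : H}
    {e f : OneParam p H} (he : HasWeight T 1 e) (hf : HasWeight T 1 f) (hw : Commute T w)
    (hef : Comm e f) (h : w * e 1 = e 1 * (f 1)⁻¹ * w) (x : zInvP p) :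
    w * e x = e x * f (-x) * w := by
  refine zInvP_induction (fun x => w * e x = e x * f (-x) * w) (fun i => ?_) (fun x hx => ?_) x
  · rw [OneParam.map_neg, map_intCast, map_intCast, ← inv_zpow,
      ← ((hef 1 1).inv_right).mul_zpow, ← mul_inv_eq_iff_eq_mul, ← conj_zpow, h,
      mul_inv_cancel_right]
  · rw [← mul_neg, ← he, ← hf] at hx
    have h1 : T * (w * e x) * T⁻¹ = T * (e x * f (-x) * w) * T⁻¹ := by
      calc T * (w * e x) * T⁻¹ = (T * w) * e x * T⁻¹ := by group
        _ = w * (T * e x * T⁻¹) := by rw [hw.eq]; group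
        _ = T * e x * f (-x) * T⁻¹ * w * T * T⁻¹ := by rw [hx]; group
        _ = T * e x * f (-x) * T⁻¹ * (w * T) * T⁻¹ := by group
        _ = _ := by rw [← hw.eq]; group
    exact mul_left_cancel (mul_right_cancel h1)

/-- Elements satisfying the relations of the presentation belong to a frame. -/
theorem exists_frame {p : Nat.Primes} {H : Type*} [Group H] (g : Fin 10 → H)
    (hg : ∀ q ∈ tildeGRelations p g, q.1 = q.2) :
    ∃ F : Frame p H, F.t = g 0 ∧ F.s = g 1 ∧ F.w = g 2 ∧ F.e12 1 = g 3 ∧ F.e13 1 = g 4 ∧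
      F.e23 1 = g 5 ∧ F.e24 1 = g 6 ∧ F.e25 1 = g 7 ∧ F.e34 1 = g 8 ∧ F.e35 1 = g 9 := by
  simp only [tildeGRelations, List.forall_mem_cons, List.not_mem_nil, false_imp_iff,
    implies_true, and_true] at hg
  generalize g 0 = t at *
  generalize g 1 = s at *
  generalize g 2 = w at *
  generalize g 3 = a12 at *
  generalize g 4 = a13 at *
  generalize g 5 = a23 at *
  generalize g 6 = a24 at *
  generalize g 7 = a25 at *
  generalize g 8 = a34 at *
  generalize g 9 = a35 at *
  obtain ⟨ts, tw, sw, t12, s12, s13, t13, t23, s23, t24, s24, t25, s25, s34, t34, s35, t35,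
    h12_13, h12_23, h13_23, h12_34, h12_35, h13_24, h13_25, h23_24, h23_25, h23_34, h23_35,
    h24_34, h25_35, h24_35, h25_34, h24_25, h34_35, w12, w13, w23, w25, w35, w24, w34⟩ := hg
  change Commute t s at ts
  change Commute t w at tw
  change Commute s w at sw
  obtain ⟨e12, rfl, T12, C12⟩ := exists_of_conj_eq_pow t⁻¹ a12 t12
  obtain ⟨e13, rfl, T13, C13⟩ := exists_of_conj_eq_pow s⁻¹ a13 s13
  obtain ⟨e23, rfl, T23, C23⟩ := exists_of_conj_eq_pow t a23 t23
  obtain ⟨e24, rfl, T24, C24⟩ := exists_of_conj_eq_pow t a24 t24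
  obtain ⟨e25, rfl, T25, C25⟩ := exists_of_conj_eq_pow t a25 t25
  obtain ⟨e34, rfl, T34, C34⟩ := exists_of_conj_eq_pow s a34 s34
  obtain ⟨e35, rfl, T35, C35⟩ := exists_of_conj_eq_pow s a35 s35
  have T12' : HasWeight t (-1) e12 := by simpa using T12.inv
  have S12 : HasWeight s 0 e12 := hasWeight_zero (C12 s ts.symm.inv_right s12)
  have S13 : HasWeight s (-1) e13 := by simpa using T13.inv
  have T13' : HasWeight t 0 e13 := hasWeight_zero (C13 t ts.inv_right t13)
  have TS23 : HasWeight (t * s) 0 e23 :=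
    hasWeight_zero (C23 (t * s) ((Commute.refl t).mul_left ts.symm) s23)
  have S23 : HasWeight s (-1) e23 := by simpa using T23.inv.mul TS23
  have S24 : HasWeight s 0 e24 := hasWeight_zero (C24 s ts.symm s24)
  have S25 : HasWeight s 0 e25 := hasWeight_zero (C25 s ts.symm s25)
  have T34' : HasWeight t 0 e34 := hasWeight_zero (C34 t ts t34)
  have T35' : HasWeight t 0 e35 := hasWeight_zero (C35 t ts t35)
  have W12 := C12 w tw.symm.inv_right w12
  have W13 := C13 w sw.symm.inv_right w13
  have W23 := C23 w tw.symm w23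
  have W25 := C25 w tw.symm w25
  have W35 := C35 w sw.symm w35
  -- The weights of two roots that are not opposite are independent or equal, so some torus element
  -- multiplies both parameters by `p`.
  have wt : ∀ {e : OneParam p H} {i j : ℤ} (m l k : ℤ), HasWeight t i e → HasWeight s j e →
      m * i + l * j = k → HasWeight (t ^ m * s ^ l) k e := by
    intro e i j m l k h1 h2 h3
    rw [← h3]
    exact (h1.zpow m).mul (h2.zpow l)
  have H12_13 : Comm e12 e13 := comm_of_scaling (T := t ^ (-1 : ℤ) * s ^ (-1 : ℤ))
    (wt _ _ _ T12' S12 (by norm_num)) (wt _ _ _ T13' S13 (by norm_num)) h12_13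
  have H12_23 : Heis e12 e23 e13 := heis_of_scaling (T := t ^ (-1 : ℤ) * s ^ (-2 : ℤ))
    (wt _ _ _ T12' S12 (by norm_num)) (wt _ _ _ T23 S23 (by norm_num))
    (wt _ _ _ T13' S13 (by norm_num)) h12_23 (Commute.symm h12_13) h13_23
  have H13_23 : Comm e13 e23 := comm_of_scaling (T := t ^ (0 : ℤ) * s ^ (-1 : ℤ))
    (wt _ _ _ T13' S13 (by norm_num)) (wt _ _ _ T23 S23 (by norm_num)) h13_23
  have H12_34 : Comm e12 e34 := comm_of_scaling (T := t ^ (-1 : ℤ) * s ^ (1 : ℤ))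
    (wt _ _ _ T12' S12 (by norm_num)) (wt _ _ _ T34' T34 (by norm_num)) h12_34
  have H12_35 : Comm e12 e35 := comm_of_scaling (T := t ^ (-1 : ℤ) * s ^ (1 : ℤ))
    (wt _ _ _ T12' S12 (by norm_num)) (wt _ _ _ T35' T35 (by norm_num)) h12_35
  have H13_24 : Comm e13 e24 := comm_of_scaling (T := t ^ (1 : ℤ) * s ^ (-1 : ℤ))
    (wt _ _ _ T13' S13 (by norm_num)) (wt _ _ _ T24 S24 (by norm_num)) h13_24
  have H13_25 : Comm e13 e25 := comm_of_scaling (T := t ^ (1 : ℤ) * s ^ (-1 : ℤ))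
    (wt _ _ _ T13' S13 (by norm_num)) (wt _ _ _ T25 S25 (by norm_num)) h13_25
  have H23_24 : Comm e23 e24 := comm_of_scaling T23 T24 h23_24
  have H23_25 : Comm e23 e25 := comm_of_scaling T23 T25 h23_25
  have H23_34 : Heis e23 e34 e24 := heis_of_scaling (T := t ^ (2 : ℤ) * s ^ (1 : ℤ))
    (wt _ _ _ T23 S23 (by norm_num)) (wt _ _ _ T34' T34 (by norm_num))
    (wt _ _ _ T24 S24 (by norm_num)) h23_34 (Commute.symm h23_24) h24_34
  have H23_35 : Heis e23 e35 e25 := heis_of_scaling (T := t ^ (2 : ℤ) * s ^ (1 : ℤ))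
    (wt _ _ _ T23 S23 (by norm_num)) (wt _ _ _ T35' T35 (by norm_num))
    (wt _ _ _ T25 S25 (by norm_num)) h23_35 (Commute.symm h23_25) h25_35
  have H24_34 : Comm e24 e34 := comm_of_scaling (T := t ^ (1 : ℤ) * s ^ (1 : ℤ))
    (wt _ _ _ T24 S24 (by norm_num)) (wt _ _ _ T34' T34 (by norm_num)) h24_34
  have H25_35 : Comm e25 e35 := comm_of_scaling (T := t ^ (1 : ℤ) * s ^ (1 : ℤ))
    (wt _ _ _ T25 S25 (by norm_num)) (wt _ _ _ T35' T35 (by norm_num)) h25_35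
  have H24_35 : Comm e24 e35 := comm_of_scaling (T := t ^ (1 : ℤ) * s ^ (1 : ℤ))
    (wt _ _ _ T24 S24 (by norm_num)) (wt _ _ _ T35' T35 (by norm_num)) h24_35
  have H25_34 : Comm e25 e34 := comm_of_scaling (T := t ^ (1 : ℤ) * s ^ (1 : ℤ))
    (wt _ _ _ T25 S25 (by norm_num)) (wt _ _ _ T34' T34 (by norm_num)) h25_34
  have H24_25 : Comm e24 e25 := comm_of_scaling T24 T25 h24_25
  have H34_35 : Comm e34 e35 := comm_of_scaling T34 T35 h34_35
  have W24 := shear_of_scaling T24 T25 tw H24_25 w24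
  have W34 := shear_of_scaling T34 T35 sw H34_35 w34
  obtain ⟨e14, H12_24, D14, D14', K12, K13, K24, K34, K23, T14, S14⟩ :=
    (AbelsColumn.mk (t := t) (s := s) H12_13 H12_23 H13_23 H12_34 H13_24 H23_34 H24_34
      T13' T34' S12 S24).exists_corner
  obtain ⟨e15, H12_25, D15, D15', L12, L13, L25, L35, L23, T15, S15⟩ :=
    (AbelsColumn.mk (t := t) (s := s) H12_13 H12_23 H13_23 H12_35 H13_25 H23_35 H25_35
      T13' T35' S12 S25).exists_corner
  have L24 : Comm e15 e24 := fun x y =>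
    (D15' _ _ (fun r => (H13_24 r y).symm) (fun r => H24_35 y r)).symm
  have K25 : Comm e14 e25 := fun x y =>
    (D14' _ _ (fun r => (H13_25 r y).symm) (fun r => H25_34 y r)).symm
  have K15 : Comm e14 e15 := fun x y =>
    D15 _ _ (fun r => K12 x r) (fun r => K25 x r)
  -- what `w` does to the corners follows from what it does to their factors
  have W15 : ∀ x, Commute w (e15 x) := fun x => D15 _ _ W12 W25
  have W14 : ∀ x, w * e14 x = e14 x * e15 (-x) * w := by
    intro x
    have h1 := H12_24 x 1
    have h2 := H12_25 x (-1)
    rw [mul_one] at h1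
    rw [mul_neg, mul_one] at h2
    have h3 := (W12 x).eq
    have h4 := W24 1
    have h5 := (L24 (-x) 1).eq
    have h6 := (K15 x (-x)).eq
    generalize e12 x = X at *
    generalize e24 1 = B at *
    generalize e25 (-1) = B' at *
    generalize e14 x = E at *
    generalize e15 (-x) = E' at *
    have h7 : w * E * B * X = E * E' * w * B * X := by
      calc w * E * B * X = w * (X * B) := by rw [h1]; group
        _ = X * (w * B) := by rw [← mul_assoc, h3, mul_assoc]
        _ = X * B * B' * w := by rw [h4]; group
        _ = E * B * (X * B') * w := by rw [h1]; group
        _ = E * (B * E') * B' * (X * w) := by rw [h2]; group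
        _ = E * E' * (B * B' * w) * X := by rw [← h5, ← h3]; group
        _ = _ := by rw [← h4]; group
    exact mul_right_cancel (mul_right_cancel h7)
  exact ⟨{
    t := t, s := s, w := w, e12 := e12, e13 := e13, e14 := e14, e15 := e15, e23 := e23, e24 := e24
    e25 := e25, e34 := e34, e35 := e35
    ts := ts, tw := tw, sw := sw
    t12 := T12', t13 := T13', t14 := T14, t15 := T15, t23 := T23, t24 := T24, t25 := T25
    t34 := T34', t35 := T35'
    s12 := S12, s13 := S13, s14 := S14, s15 := S15, s23 := S23, s24 := S24, s25 := S25
    s34 := T34, s35 := T35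
    w12 := W12, w13 := W13, w15 := W15, w23 := W23, w25 := W25, w35 := W35
    w14 := W14, w24 := W24, w34 := W34
    h12_13 := H12_13, h12_14 := K12.symm, h12_15 := L12.symm, h12_23 := H12_23
    h12_24 := H12_24, h12_25 := H12_25, h12_34 := H12_34, h12_35 := H12_35
    h13_14 := K13.symm, h13_15 := L13.symm, h13_23 := H13_23, h13_24 := H13_24, h13_25 := H13_25
    h14_15 := K15, h14_24 := K24, h14_25 := K25, h15_25 := L25
    h23_24 := H23_24, h23_25 := H23_25, h23_34 := H23_34, h23_35 := H23_35
    h24_25 := H24_25, h24_34 := H24_34, h24_35 := H24_35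
    h25_35 := H25_35 },
    rfl, rfl, rfl, rfl, rfl, rfl, rfl, rfl, rfl, rfl⟩

/-! ### Normal forms -/

namespace Frame

variable {p : Nat.Primes} {H : Type*} [Group H] (F : Frame p H)

/-- The collected words: the roots row by row from the bottom, then the powers of `w` and the
torus. -/
def normalForm (n k m : ℤ) (x12 x13 x14 x15 x23 x24 x25 x34 x35 : zInvP p) : H :=
  F.e34 x34 * (F.e35 x35 * (F.e23 x23 * (F.e24 x24 * (F.e25 x25 * (F.e12 x12 * (F.e13 x13 *
    (F.e14 x14 * (F.e15 x15 * (F.w ^ m * (F.t ^ n * F.s ^ k))))))))))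

/-- The set of all collected words. -/
def normalForms : Set H :=
  {h | ∃ (n k m : ℤ) (x12 x13 x14 x15 x23 x24 x25 x34 x35 : zInvP p),
    h = F.normalForm n k m x12 x13 x14 x15 x23 x24 x25 x34 x35}

theorem merge (e : OneParam p H) (x y : zInvP p) (z : H) : e x * (e y * z) = e (x + y) * z := by
  rw [OneParam.map_add, mul_assoc]

theorem heis_left_comm {e f g : OneParam p H} (h : Heis e f g) (x y : zInvP p) (z : H) :
    e x * (f y * z) = g (x * y) * (f y * (e x * z)) := by
  rw [← mul_assoc, h x y, mul_assoc, mul_assoc]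

theorem shear_zpow {w : H} {e f : OneParam p H} (hf : ∀ x, Commute w (f x))
    (h : ∀ x, w * e x = e x * f (-x) * w) (j : ℤ) (x : zInvP p) (z : H) :
    w ^ j * (e x * z) = e x * (f (-(j * x)) * (w ^ j * z)) := by
  have hj : ∀ j : ℤ, w ^ j * e x * (w ^ j)⁻¹ = e x * f (-(j * x)) := by
    have hb : w * e x * w⁻¹ = e x * f (-x) := by rw [h, mul_inv_cancel_right]
    have hb' : w⁻¹ * e x * w = e x * f x := by
      rw [mul_assoc, inv_mul_eq_iff_eq_mul, ← mul_assoc, h x, OneParam.map_neg, mul_assoc _ w,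
        (hf x).eq, mul_assoc, inv_mul_cancel_left]
    intro j
    induction j using Int.induction_on with
    | zero => simp [OneParam.map_zero]
    | succ j ih =>
      calc w ^ ((j : ℤ) + 1) * e x * (w ^ ((j : ℤ) + 1))⁻¹
          = w * (w ^ (j : ℤ) * e x * (w ^ (j : ℤ))⁻¹) * w⁻¹ := by
            rw [add_comm, zpow_add, zpow_one]; group
        _ = w * e x * (f (-((j : ℤ) * x)) * w⁻¹) := by rw [ih]; group
        _ = w * e x * w⁻¹ * f (-((j : ℤ) * x)) := by rw [← ((hf _).inv_left).eq]; group
        _ = e x * f (-((((j : ℤ) + 1 : ℤ) : zInvP p) * x)) := by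
          rw [hb, mul_assoc, ← OneParam.map_add]
          congr 2
          push_cast
          ring
    | pred j ih =>
      calc w ^ (-(j : ℤ) - 1) * e x * (w ^ (-(j : ℤ) - 1))⁻¹
          = w⁻¹ * (w ^ (-(j : ℤ)) * e x * (w ^ (-(j : ℤ)))⁻¹) * w := by
            rw [sub_eq_add_neg, add_comm, zpow_add, zpow_neg_one]; group
        _ = w⁻¹ * e x * (f (-((-(j : ℤ) : ℤ) * x)) * w) := by rw [ih]; group
        _ = w⁻¹ * e x * w * f (-((-(j : ℤ) : ℤ) * x)) := by rw [← (hf _).eq]; group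
        _ = e x * f (-(((-(j : ℤ) - 1 : ℤ) : zInvP p) * x)) := by
          rw [hb', mul_assoc, ← OneParam.map_add]
          congr 2
          push_cast
          ring
  rw [← mul_assoc (e x), ← hj]
  group

theorem e34_mul_mem {h : H} (hh : h ∈ F.normalForms) (r : zInvP p) :
    F.e34 r * h ∈ F.normalForms := by
  obtain ⟨n, k, m, x12, x13, x14, x15, x23, x24, x25, x34, x35, rfl⟩ := hh
  refine ⟨n, k, m, x12, x13, x14, x15, x23, x24, x25, r + x34, x35, ?_⟩
  simp only [normalForm, merge]

theorem e23_mul_mem {h : H} (hh : h ∈ F.normalForms) (r : zInvP p) :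
    F.e23 r * h ∈ F.normalForms := by
  obtain ⟨n, k, m, x12, x13, x14, x15, x23, x24, x25, x34, x35, rfl⟩ := hh
  refine ⟨n, k, m, x12, x13, x14, x15, r + x23, r * x34 + x24, r * x35 + x25, x34, x35, ?_⟩
  simp only [normalForm]
  rw [heis_left_comm F.h23_34, heis_left_comm F.h23_35, merge F.e23,
    (F.h24_34 _ _).left_comm, (F.h25_35 _ _).left_comm, (F.h24_35 _ _).left_comm,
    (F.h23_25 _ _).symm.left_comm, (F.h23_24 _ _).symm.left_comm,
    (F.h24_25 _ _).symm.left_comm, merge, merge]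

theorem e12_mul_mem {h : H} (hh : h ∈ F.normalForms) (r : zInvP p) :
    F.e12 r * h ∈ F.normalForms := by
  obtain ⟨n, k, m, x12, x13, x14, x15, x23, x24, x25, x34, x35, rfl⟩ := hh
  refine ⟨n, k, m, r + x12, r * x23 + x13, r * x24 + x14, r * x25 + x15, x23, x24, x25, x34, x35,
    ?_⟩
  simp only [normalForm]
  rw [(F.h12_34 _ _).left_comm, (F.h12_35 _ _).left_comm, heis_left_comm F.h12_23,
    heis_left_comm F.h12_24, heis_left_comm F.h12_25, merge F.e12,
    (F.h15_25 _ _).left_comm, (F.h12_15 _ _).symm.left_comm, (F.h13_15 _ _).symm.left_comm,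
    (F.h14_15 _ _).symm.left_comm, merge F.e15,
    (F.h14_24 _ _).left_comm, (F.h14_25 _ _).left_comm, (F.h12_14 _ _).symm.left_comm,
    (F.h13_14 _ _).symm.left_comm, merge F.e14,
    (F.h13_23 _ _).left_comm, (F.h13_24 _ _).left_comm, (F.h13_25 _ _).left_comm,
    (F.h12_13 _ _).symm.left_comm, merge F.e13]

theorem w_mul_mem {h : H} (hh : h ∈ F.normalForms) (j : ℤ) : F.w ^ j * h ∈ F.normalForms := by
  obtain ⟨n, k, m, x12, x13, x14, x15, x23, x24, x25, x34, x35, rfl⟩ := hh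
  refine ⟨n, k, j + m, x12, x13, x14, -(j * x14) + x15, x23, x24, -(j * x24) + x25, x34,
    -(j * x34) + x35, ?_⟩
  simp only [normalForm]
  rw [shear_zpow F.w35 F.w34, ((F.w35 _).zpow_left j).left_comm, merge,
    ((F.w23 _).zpow_left j).left_comm, shear_zpow F.w25 F.w24, ((F.w25 _).zpow_left j).left_comm,
    merge, ((F.w12 _).zpow_left j).left_comm, ((F.w13 _).zpow_left j).left_comm,
    shear_zpow F.w15 F.w14, ((F.w15 _).zpow_left j).left_comm, merge, zpow_add, mul_assoc]

theorem t_mul_mem {h : H} (hh : h ∈ F.normalForms) (j : ℤ) : F.t ^ j * h ∈ F.normalForms := by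
  obtain ⟨n, k, m, x12, x13, x14, x15, x23, x24, x25, x34, x35, rfl⟩ := hh
  simp only [normalForm]
  rw [F.t34.mul_left_comm, F.t35.mul_left_comm, F.t23.mul_left_comm, F.t24.mul_left_comm,
    F.t25.mul_left_comm, F.t12.mul_left_comm, F.t13.mul_left_comm, F.t14.mul_left_comm,
    F.t15.mul_left_comm, ((F.tw.zpow_left j).zpow_right m).left_comm, ← mul_assoc (F.t ^ j),
    ← zpow_add]
  exact ⟨_, _, _, _, _, _, _, _, _, _, _, _, rfl⟩

theorem s_mul_mem {h : H} (hh : h ∈ F.normalForms) (j : ℤ) : F.s ^ j * h ∈ F.normalForms := by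
  obtain ⟨n, k, m, x12, x13, x14, x15, x23, x24, x25, x34, x35, rfl⟩ := hh
  simp only [normalForm]
  rw [F.s34.mul_left_comm, F.s35.mul_left_comm, F.s23.mul_left_comm, F.s24.mul_left_comm,
    F.s25.mul_left_comm, F.s12.mul_left_comm, F.s13.mul_left_comm, F.s14.mul_left_comm,
    F.s15.mul_left_comm, ((F.sw.zpow_left j).zpow_right m).left_comm,
    ((F.ts.symm.zpow_left j).zpow_right n).left_comm, ← zpow_add]
  exact ⟨_, _, _, _, _, _, _, _, _, _, _, _, rfl⟩

open scoped Pointwise in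
/-- Left multiplication by the generators permutes the collected words, so these exhaust the
subgroup generated by the values of the frame. -/
theorem mem_normalForms_of_mem_closure {h : H}
    (hh : h ∈ Subgroup.closure ({F.t, F.s, F.w} ∪ Set.range F.e12 ∪ Set.range F.e23 ∪
      Set.range F.e34)) : h ∈ F.normalForms := by
  have hstab : ∀ x : H, (∀ h ∈ F.normalForms, x * h ∈ F.normalForms) →
      (∀ h ∈ F.normalForms, x⁻¹ * h ∈ F.normalForms) →
      x ∈ MulAction.stabilizer H F.normalForms := by
    intro x h1 h2
    rw [MulAction.mem_stabilizer_iff]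
    ext y
    rw [Set.mem_smul_set_iff_inv_smul_mem, smul_eq_mul]
    exact ⟨fun hy => by simpa using h1 _ hy, h2 y⟩
  have hle : h ∈ MulAction.stabilizer H F.normalForms := by
    refine (Subgroup.closure_le _).2 ?_ hh
    rintro x ((((rfl | rfl | rfl) | ⟨r, rfl⟩) | ⟨r, rfl⟩) | ⟨r, rfl⟩)
    · exact hstab _ (fun h hh => by simpa using F.t_mul_mem hh 1)
        (fun h hh => by simpa using F.t_mul_mem hh (-1))
    · exact hstab _ (fun h hh => by simpa using F.s_mul_mem hh 1)
        (fun h hh => by simpa using F.s_mul_mem hh (-1))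
    · exact hstab _ (fun h hh => by simpa using F.w_mul_mem hh 1)
        (fun h hh => by simpa using F.w_mul_mem hh (-1))
    · exact hstab _ (fun h hh => F.e12_mul_mem hh r)
        (fun h hh => by rw [← OneParam.map_neg]; exact F.e12_mul_mem hh (-r))
    · exact hstab _ (fun h hh => F.e23_mul_mem hh r)
        (fun h hh => by rw [← OneParam.map_neg]; exact F.e23_mul_mem hh (-r))
    · exact hstab _ (fun h hh => F.e34_mul_mem hh r)
        (fun h hh => by rw [← OneParam.map_neg]; exact F.e34_mul_mem hh (-r))
  have hone : (1 : H) ∈ F.normalForms :=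
    ⟨0, 0, 0, 0, 0, 0, 0, 0, 0, 0, 0, 0, by simp [normalForm, OneParam.map_zero]⟩
  have := Set.smul_mem_smul_set (a := h) hone
  rwa [MulAction.mem_stabilizer_iff.1 hle, smul_eq_mul, mul_one] at this

end Frame

/-! ### Coordinates, generators and the presentation of `tildeG p` -/

theorem zPow_injective (p : Nat.Primes) {m n : ℤ} (h : zPow p m = zPow p n) : m = n :=
  zpow_right_injective₀ (by exact_mod_cast p.2.pos) (by exact_mod_cast p.2.ne_one)
    (congrArg Subtype.val h)

theorem det_tildeGMatrix (p : Nat.Primes) (n k m : ℤ)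
    (x12 x13 x14 x15 x23 x24 x25 x34 x35 : ℚ) :
    (tildeGMatrix p n k m x12 x13 x14 x15 x23 x24 x25 x34 x35).det ≠ 0 := by
  have hp : (p : ℚ) ≠ 0 := by exact_mod_cast p.2.ne_zero
  rw [Matrix.det_of_isUpperTriangular]
  · simp [Fin.prod_univ_five, tildeGMatrix, zpow_ne_zero _ hp]
  · intro i j hij
    fin_cases i <;> fin_cases j <;> simp_all [tildeGMatrix]

/-- The element of `tildeG p` with the given coordinates. -/
noncomputable def tG {p : Nat.Primes} (n k m : ℤ)
    (x12 x13 x14 x15 x23 x24 x25 x34 x35 : zInvP p) : tildeG p :=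
  ⟨Matrix.GeneralLinearGroup.mkOfDetNeZero _
    (det_tildeGMatrix p n k m x12 x13 x14 x15 x23 x24 x25 x34 x35),
    n, k, m, x12, x12.2, x13, x13.2, x14, x14.2, x15, x15.2, x23, x23.2, x24, x24.2, x25, x25.2,
    x34, x34.2, x35, x35.2, rfl⟩

section

variable {p : Nat.Primes}

theorem tG_val (n k m : ℤ) (x12 x13 x14 x15 x23 x24 x25 x34 x35 : zInvP p) :
    ((tG n k m x12 x13 x14 x15 x23 x24 x25 x34 x35 : tildeG p).1 : Matrix (Fin 5) (Fin 5) ℚ) =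
      tildeGMatrix p n k m x12 x13 x14 x15 x23 x24 x25 x34 x35 := rfl

theorem tildeG_ext {g h : tildeG p}
    (H : (g.1 : Matrix (Fin 5) (Fin 5) ℚ) = (h.1 : Matrix (Fin 5) (Fin 5) ℚ)) : g = h :=
  Subtype.ext (Units.ext H)

theorem exists_eq_tG (g : tildeG p) :
    ∃ (n k m : ℤ) (x12 x13 x14 x15 x23 x24 x25 x34 x35 : zInvP p),
      g = tG n k m x12 x13 x14 x15 x23 x24 x25 x34 x35 := by
  obtain ⟨n, k, m, a12, h12, a13, h13, a14, h14, a15, h15, a23, h23, a24, h24, a25, h25,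
      a34, h34, a35, h35, hg⟩ := g.2
  exact ⟨n, k, m, ⟨a12, h12⟩, ⟨a13, h13⟩, ⟨a14, h14⟩, ⟨a15, h15⟩, ⟨a23, h23⟩, ⟨a24, h24⟩,
    ⟨a25, h25⟩, ⟨a34, h34⟩, ⟨a35, h35⟩, tildeG_ext hg⟩

theorem tG_mul (n k m n' k' m' : ℤ)
    (a12 a13 a14 a15 a23 a24 a25 a34 a35 b12 b13 b14 b15 b23 b24 b25 b34 b35 : zInvP p) :
    (tG n k m a12 a13 a14 a15 a23 a24 a25 a34 a35 *
      tG n' k' m' b12 b13 b14 b15 b23 b24 b25 b34 b35 : tildeG p) =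
    tG (n + n') (k + k') (m + m')
      (b12 + a12 * zPow p n')
      (b13 + a12 * b23 + a13 * zPow p k')
      (b14 + a12 * b24 + a13 * b34 + a14)
      (b15 + a12 * b25 + a13 * b35 + a14 * m' + a15)
      (zPow p n * b23 + a23 * zPow p k')
      (zPow p n * b24 + a23 * b34 + a24)
      (zPow p n * b25 + a23 * b35 + a24 * m' + a25)
      (zPow p k * b34 + a34)
      (zPow p k * b35 + a34 * m' + a35) :=
  tildeG_ext <| by
    rw [Subgroup.coe_mul, Units.val_mul, tG_val, tG_val, tG_val, tildeGMatrix_mul]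
    rfl

theorem tG_one : (tG 0 0 0 0 0 0 0 0 0 0 0 0 : tildeG p) = 1 := by
  refine tildeG_ext ?_
  rw [tG_val]
  ext i j
  fin_cases i <;> fin_cases j <;> simp [tildeGMatrix]

theorem tG_inj {n k m n' k' m' : ℤ}
    {a12 a13 a14 a15 a23 a24 a25 a34 a35 b12 b13 b14 b15 b23 b24 b25 b34 b35 : zInvP p} :
    (tG n k m a12 a13 a14 a15 a23 a24 a25 a34 a35 : tildeG p) =
      tG n' k' m' b12 b13 b14 b15 b23 b24 b25 b34 b35 ↔
    n = n' ∧ k = k' ∧ m = m' ∧ a12 = b12 ∧ a13 = b13 ∧ a14 = b14 ∧ a15 = b15 ∧ a23 = b23 ∧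
      a24 = b24 ∧ a25 = b25 ∧ a34 = b34 ∧ a35 = b35 := by
  constructor
  · intro h
    have H : ∀ i j, tildeGMatrix p n k m a12 a13 a14 a15 a23 a24 a25 a34 a35 i j =
        tildeGMatrix p n' k' m' b12 b13 b14 b15 b23 b24 b25 b34 b35 i j := by
      intro i j
      rw [← tG_val, h, tG_val]
    refine ⟨zPow_injective p (Subtype.ext (H 1 1)), zPow_injective p (Subtype.ext (H 2 2)),
      Int.cast_injective (α := ℚ) (H 3 4), Subtype.ext (H 0 1), Subtype.ext (H 0 2),
      Subtype.ext (H 0 3), Subtype.ext (H 0 4), Subtype.ext (H 1 2), Subtype.ext (H 1 3),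
      Subtype.ext (H 1 4), Subtype.ext (H 2 3), Subtype.ext (H 2 4)⟩
  · rintro ⟨rfl, rfl, rfl, rfl, rfl, rfl, rfl, rfl, rfl, rfl, rfl, rfl⟩
    rfl

theorem zpow_of_map_add {G : Type*} [Group G] (f : ℤ → G) (hf : ∀ a b, f (a + b) = f a * f b)
    (m : ℤ) : f 1 ^ m = f m := by
  let φ : Multiplicative ℤ →* G := MonoidHom.mk' (fun a => f a.toAdd) fun a b => hf _ _
  have := map_zpow φ (Multiplicative.ofAdd 1) m
  simpa [φ, ← ofAdd_zsmul] using this.symm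

variable (p)

/-- The torus element `diag(1, p ^ n, 1, 1, 1)`. -/
noncomputable def torusT (n : ℤ) : tildeG p := tG n 0 0 0 0 0 0 0 0 0 0 0

/-- The torus element `diag(1, 1, p ^ k, 1, 1)`. -/
noncomputable def torusS (k : ℤ) : tildeG p := tG 0 k 0 0 0 0 0 0 0 0 0 0

/-- The elementary matrix with the integer `m` at position `(4, 5)`. -/
noncomputable def elemW (m : ℤ) : tildeG p := tG 0 0 m 0 0 0 0 0 0 0 0 0

/-- The elementary matrices at position `(1, 2)`. -/
noncomputable def elem12 : OneParam p (tildeG p) where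
  toFun x := tG 0 0 0 x 0 0 0 0 0 0 0 0
  map_add' x y := by simp [tG_mul, zPow_zero, add_comm]

/-- The elementary matrices at position `(1, 3)`. -/
noncomputable def elem13 : OneParam p (tildeG p) where
  toFun x := tG 0 0 0 0 x 0 0 0 0 0 0 0
  map_add' x y := by simp [tG_mul, zPow_zero, add_comm]

/-- The elementary matrices at position `(1, 4)`. -/
noncomputable def elem14 : OneParam p (tildeG p) where
  toFun x := tG 0 0 0 0 0 x 0 0 0 0 0 0
  map_add' x y := by simp [tG_mul, zPow_zero, add_comm]

/-- The elementary matrices at position `(1, 5)`. -/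
noncomputable def elem15 : OneParam p (tildeG p) where
  toFun x := tG 0 0 0 0 0 0 x 0 0 0 0 0
  map_add' x y := by simp [tG_mul, zPow_zero, add_comm]

/-- The elementary matrices at position `(2, 3)`. -/
noncomputable def elem23 : OneParam p (tildeG p) where
  toFun x := tG 0 0 0 0 0 0 0 x 0 0 0 0
  map_add' x y := by simp [tG_mul, zPow_zero, add_comm]

/-- The elementary matrices at position `(2, 4)`. -/
noncomputable def elem24 : OneParam p (tildeG p) where
  toFun x := tG 0 0 0 0 0 0 0 0 x 0 0 0
  map_add' x y := by simp [tG_mul, zPow_zero, add_comm]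

/-- The elementary matrices at position `(2, 5)`. -/
noncomputable def elem25 : OneParam p (tildeG p) where
  toFun x := tG 0 0 0 0 0 0 0 0 0 x 0 0
  map_add' x y := by simp [tG_mul, zPow_zero, add_comm]

/-- The elementary matrices at position `(3, 4)`. -/
noncomputable def elem34 : OneParam p (tildeG p) where
  toFun x := tG 0 0 0 0 0 0 0 0 0 0 x 0
  map_add' x y := by simp [tG_mul, zPow_zero, add_comm]

/-- The elementary matrices at position `(3, 5)`. -/
noncomputable def elem35 : OneParam p (tildeG p) where
  toFun x := tG 0 0 0 0 0 0 0 0 0 0 0 x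
  map_add' x y := by simp [tG_mul, zPow_zero, add_comm]

/-- The generators of `tildeG p`, in the order of `tildeGRelations`. -/
noncomputable def tildeGGenerators : Fin 10 → tildeG p :=
  ![torusT p 1, torusS p 1, elemW p 1, elem12 p 1, elem13 p 1, elem23 p 1, elem24 p 1,
    elem25 p 1, elem34 p 1, elem35 p 1]

variable {p}

theorem hasWeight_iff {H : Type*} [Group H] {T : H} {i : ℤ} {e : OneParam p H} :
    HasWeight T i e ↔ ∀ x, T * e x = e (zPow p i * x) * T :=
  forall_congr' fun _ => mul_inv_eq_iff_eq_mul

theorem OneParam.HasWeight.conj_eq_pow {H : Type*} [Group H] {T : H} {e : OneParam p H}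
    (h : HasWeight T 1 e) : T * e 1 * T⁻¹ = e 1 ^ (p : ℕ) := by
  have hp : zPow p 1 * 1 = (((p : ℕ) : ℤ) : zInvP p) := Subtype.ext (by simp [zPow])
  rw [h, hp, OneParam.map_intCast, zpow_natCast]

theorem elem12_weight : HasWeight (torusT p 1)⁻¹ 1 (elem12 p) := by
  rw [← neg_neg (1 : ℤ)]
  refine HasWeight.inv (hasWeight_iff.2 fun x => ?_)
  have hx : x = zPow p (-1) * x * zPow p 1 := by
    rw [mul_right_comm, ← zPow_add, neg_add_cancel, zPow_zero, one_mul]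
  simpa [torusT, elem12, tG_mul, tG_inj, zPow_zero] using hx

theorem elem13_weight : HasWeight (torusS p 1)⁻¹ 1 (elem13 p) := by
  rw [← neg_neg (1 : ℤ)]
  refine HasWeight.inv (hasWeight_iff.2 fun x => ?_)
  have hx : x = zPow p (-1) * x * zPow p 1 := by
    rw [mul_right_comm, ← zPow_add, neg_add_cancel, zPow_zero, one_mul]
  simpa [torusS, elem13, tG_mul, tG_inj, zPow_zero] using hx

theorem elem23_weight : HasWeight (torusT p 1) 1 (elem23 p) :=
  hasWeight_iff.2 fun x => by simp [torusT, elem23, tG_mul, zPow_zero]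

theorem elem24_weight : HasWeight (torusT p 1) 1 (elem24 p) :=
  hasWeight_iff.2 fun x => by simp [torusT, elem24, tG_mul, zPow_zero]

theorem elem25_weight : HasWeight (torusT p 1) 1 (elem25 p) :=
  hasWeight_iff.2 fun x => by simp [torusT, elem25, tG_mul, zPow_zero]

theorem elem34_weight : HasWeight (torusS p 1) 1 (elem34 p) :=
  hasWeight_iff.2 fun x => by simp [torusS, elem34, tG_mul, zPow_zero]

theorem elem35_weight : HasWeight (torusS p 1) 1 (elem35 p) :=
  hasWeight_iff.2 fun x => by simp [torusS, elem35, tG_mul, zPow_zero]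

theorem tildeGGenerators_relations :
    ∀ q ∈ tildeGRelations p (tildeGGenerators p), q.1 = q.2 := by
  simp only [tildeGRelations, List.forall_mem_cons, List.not_mem_nil, false_imp_iff,
    implies_true, and_true, tildeGGenerators]
  refine ⟨?_, ?_, ?_, elem12_weight.conj_eq_pow, ?_, elem13_weight.conj_eq_pow, ?_,
    elem23_weight.conj_eq_pow, ?_, elem24_weight.conj_eq_pow, ?_, elem25_weight.conj_eq_pow, ?_,
    elem34_weight.conj_eq_pow, ?_, elem35_weight.conj_eq_pow, ?_⟩
  all_goals
    simp only [Matrix.cons_val, ← OneParam.map_neg]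
    simp [torusT, torusS, elemW, elem12, elem13, elem23, elem24, elem25,
      elem34, elem35, tG_mul, zPow_zero]

theorem elem12_mul_elem24 : Heis (elem12 p) (elem24 p) (elem14 p) := by
  intro x y
  simp [elem12, elem24, elem14, tG_mul, zPow_zero]

theorem elem12_mul_elem25 : Heis (elem12 p) (elem25 p) (elem15 p) := by
  intro x y
  simp [elem12, elem25, elem15, tG_mul, zPow_zero]

theorem torusT_zpow (n : ℤ) : torusT p 1 ^ n = torusT p n :=
  zpow_of_map_add _ (fun a b => by simp [torusT, tG_mul]) n

theorem torusS_zpow (n : ℤ) : torusS p 1 ^ n = torusS p n :=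
  zpow_of_map_add _ (fun a b => by simp [torusS, tG_mul]) n

theorem elemW_zpow (n : ℤ) : elemW p 1 ^ n = elemW p n :=
  zpow_of_map_add _ (fun a b => by simp [elemW, tG_mul, zPow_zero]) n

/-- The image of a normal form in `tildeG p`: its coordinates determine those of the word, and every
element of `tildeG p` arises. -/
theorem elem_normalForm (n k m : ℤ) (x12 x13 x14 x15 x23 x24 x25 x34 x35 : zInvP p) :
    elem34 p x34 * (elem35 p x35 * (elem23 p x23 * (elem24 p x24 * (elem25 p x25 *
      (elem12 p x12 * (elem13 p x13 * (elem14 p x14 * (elem15 p x15 * (elemW p m *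
        (torusT p n * torusS p k)))))))))) =
      tG n k m (x12 * zPow p n) (x13 * zPow p k) x14 (x14 * m + x15) (x23 * zPow p k) x24
        (x24 * m + x25) x34 (x34 * m + x35) := by
  simp only [torusT, torusS, elemW, elem12, elem13, elem23, elem24, elem25, elem34, elem35,
    elem14, elem15, tG_mul, tG_inj]
  simp [zPow_zero, add_comm]

theorem OneParam.HasWeight.map {H H' : Type*} [Group H] [Group H'] {T : H} {i : ℤ}
    {e : OneParam p H} (h : HasWeight T i e) (f : H →* H') : HasWeight (f T) i (e.map f) := by
  intro x
  change f T * f (e x) * (f T)⁻¹ = f (e _)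
  rw [← h]
  simp

theorem tildeGRelations_map {H H' : Type*} [Group H] [Group H'] (f : H →* H') (g : Fin 10 → H) :
    tildeGRelations p (fun i => f (g i)) = (tildeGRelations p g).map (Prod.map f f) := by
  simp [tildeGRelations]

variable (p) in
/-- The relators of the finite presentation. -/
def tildeGRelators : Set (FreeGroup (Fin 10)) :=
  {x | x ∈ (tildeGRelations p FreeGroup.of).map fun q => q.1 * q.2⁻¹}

theorem lift_tildeGGenerators : ∀ r ∈ tildeGRelators p,
    FreeGroup.lift (tildeGGenerators p) r = 1 := by
  intro r hr
  obtain ⟨q, hq, rfl⟩ := List.mem_map.1 hr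
  rw [map_mul, map_inv, mul_inv_eq_one]
  have h1 := tildeGRelations_map (p := p) (FreeGroup.lift (tildeGGenerators p)) FreeGroup.of
  simp only [FreeGroup.lift_apply_of] at h1
  have h2 := tildeGGenerators_relations (p := p) (Prod.map _ _ q)
    (by rw [h1]; exact List.mem_map_of_mem hq)
  exact h2

/-- The group with these relators maps onto `tildeG p`. In it every element has a normal form, and the
normal form is determined by the coordinates of its image in `tildeG p`. -/
instance isFinitelyPresented_tildeG : Group.IsFinitelyPresented (tildeG p) := by
  have hfin : Finite (tildeGRelators p) := (List.finite_toSet _).to_subtype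
  obtain ⟨F, ht, hs, hw, h12, h13, h23, h24, h25, h34, h35⟩ := exists_frame (p := p)
    (PresentedGroup.of : Fin 10 → PresentedGroup (tildeGRelators p)) (by
      have h1 := tildeGRelations_map (p := p) (PresentedGroup.mk (tildeGRelators p)) FreeGroup.of
      change ∀ q ∈ tildeGRelations p (fun i => PresentedGroup.mk (tildeGRelators p)
        (FreeGroup.of i)), _
      rw [h1]
      intro q hq
      obtain ⟨q', hq', rfl⟩ := List.mem_map.1 hq
      exact PresentedGroup.mk_eq_mk_of_mul_inv_mem
        (List.mem_map_of_mem (f := fun q => q.1 * q.2⁻¹) hq'))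
  let ψ : PresentedGroup (tildeGRelators p) →* tildeG p :=
    PresentedGroup.toGroup lift_tildeGGenerators
  have hψ : ∀ i, ψ (PresentedGroup.of i) = tildeGGenerators p i :=
    fun i => PresentedGroup.toGroup.of _
  have ψt : ψ F.t = torusT p 1 := by rw [ht, hψ]; rfl
  have ψs : ψ F.s = torusS p 1 := by rw [hs, hψ]; rfl
  have ψw : ψ F.w = elemW p 1 := by rw [hw, hψ]; rfl
  have wt : ∀ {e : OneParam p _} {i : ℤ}, HasWeight F.t i e → HasWeight (torusT p 1) i (e.map ψ) :=
    fun h => ψt ▸ h.map ψ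
  have ws : ∀ {e : OneParam p _} {i : ℤ}, HasWeight F.s i e → HasWeight (torusS p 1) i (e.map ψ) :=
    fun h => ψs ▸ h.map ψ
  have ψ12 : ∀ x, ψ (F.e12 x) = elem12 p x :=
    ext_of_hasWeight (by simpa using (wt F.t12).inv) elem12_weight
      (by change ψ _ = _; rw [h12, hψ]; rfl)
  have ψ13 : ∀ x, ψ (F.e13 x) = elem13 p x :=
    ext_of_hasWeight (by simpa using (ws F.s13).inv) elem13_weight
      (by change ψ _ = _; rw [h13, hψ]; rfl)
  have ψ23 : ∀ x, ψ (F.e23 x) = elem23 p x :=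
    ext_of_hasWeight (wt F.t23) elem23_weight (by change ψ _ = _; rw [h23, hψ]; rfl)
  have ψ24 : ∀ x, ψ (F.e24 x) = elem24 p x :=
    ext_of_hasWeight (wt F.t24) elem24_weight (by change ψ _ = _; rw [h24, hψ]; rfl)
  have ψ25 : ∀ x, ψ (F.e25 x) = elem25 p x :=
    ext_of_hasWeight (wt F.t25) elem25_weight (by change ψ _ = _; rw [h25, hψ]; rfl)
  have ψ34 : ∀ x, ψ (F.e34 x) = elem34 p x :=
    ext_of_hasWeight (ws F.s34) elem34_weight (by change ψ _ = _; rw [h34, hψ]; rfl)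
  have ψ35 : ∀ x, ψ (F.e35 x) = elem35 p x :=
    ext_of_hasWeight (ws F.s35) elem35_weight (by change ψ _ = _; rw [h35, hψ]; rfl)
  -- the corner subgroups are recognized as commutators
  have ψ14 : ∀ x, ψ (F.e14 x) = elem14 p x := by
    intro x
    have h1 := congrArg ψ (F.h12_24 x 1)
    simp only [map_mul, ψ12, ψ24, mul_one, elem12_mul_elem24 x 1] at h1
    exact (mul_right_cancel (mul_right_cancel h1)).symm
  have ψ15 : ∀ x, ψ (F.e15 x) = elem15 p x := by
    intro x
    have h1 := congrArg ψ (F.h12_25 x 1)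
    simp only [map_mul, ψ12, ψ25, mul_one, elem12_mul_elem25 x 1] at h1
    exact (mul_right_cancel (mul_right_cancel h1)).symm
  have ψn : ∀ (n k m : ℤ) (x12 x13 x14 x15 x23 x24 x25 x34 x35 : zInvP p),
      ψ (F.normalForm n k m x12 x13 x14 x15 x23 x24 x25 x34 x35) =
      tG n k m (x12 * zPow p n) (x13 * zPow p k) x14 (x14 * m + x15) (x23 * zPow p k) x24
        (x24 * m + x25) x34 (x34 * m + x35) := by
    intro n k m x12 x13 x14 x15 x23 x24 x25 x34 x35
    simp only [Frame.normalForm, map_mul, map_zpow, ψt, ψs, ψw, ψ12, ψ13, ψ14, ψ15, ψ23, ψ24, ψ25,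
      ψ34, ψ35, torusT_zpow, torusS_zpow, elemW_zpow]
    exact elem_normalForm n k m x12 x13 x14 x15 x23 x24 x25 x34 x35
  have hall : ∀ h, h ∈ F.normalForms := by
    intro h
    refine F.mem_normalForms_of_mem_closure ?_
    set K := Subgroup.closure ({F.t, F.s, F.w} ∪ Set.range F.e12 ∪ Set.range F.e23 ∪
      Set.range F.e34) with hK
    have kt : F.t ∈ K := Subgroup.subset_closure (by simp)
    have ks : F.s ∈ K := Subgroup.subset_closure (by simp)
    have kw : F.w ∈ K := Subgroup.subset_closure (by simp)
    have k12 : ∀ x, F.e12 x ∈ K := fun x => Subgroup.subset_closure (by simp)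
    have k23 : ∀ x, F.e23 x ∈ K := fun x => Subgroup.subset_closure (by simp)
    have k34 : ∀ x, F.e34 x ∈ K := fun x => Subgroup.subset_closure (by simp)
    have heis : ∀ {e f g : OneParam p _}, Heis e f g → (∀ x, e x ∈ K) → (∀ x, f x ∈ K) →
        ∀ x, g x ∈ K := by
      intro e f g h he hf x
      have h1 := h x 1
      rw [mul_one] at h1
      have h2 : g x = e x * f 1 * (e x)⁻¹ * (f 1)⁻¹ := by rw [h1]; group
      rw [h2]
      exact mul_mem (mul_mem (mul_mem (he x) (hf 1)) (inv_mem (he x))) (inv_mem (hf 1))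
    have k13 := heis F.h12_23 k12 k23
    have k24 := heis F.h23_34 k23 k34
    have k35 : ∀ x, F.e35 x ∈ K := by
      intro x
      have h1 := F.w34 (-x)
      rw [neg_neg] at h1
      have h2 : F.e35 x = (F.e34 (-x))⁻¹ * (F.w * F.e34 (-x)) * F.w⁻¹ := by rw [h1]; group
      rw [h2]
      exact mul_mem (mul_mem (inv_mem (k34 _)) (mul_mem kw (k34 _))) (inv_mem kw)
    have k25 := heis F.h23_35 k23 k35
    refine PresentedGroup.generated_by _ K (fun i => ?_) h
    fin_cases i
    · exact ht ▸ kt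
    · exact hs ▸ ks
    · exact hw ▸ kw
    · exact h12 ▸ k12 1
    · exact h13 ▸ k13 1
    · exact h23 ▸ k23 1
    · exact h24 ▸ k24 1
    · exact h25 ▸ k25 1
    · exact h34 ▸ k34 1
    · exact h35 ▸ k35 1
  refine Group.IsFinitelyPresented.equiv (MulEquiv.ofBijective ψ ⟨?_, ?_⟩)
  · refine (injective_iff_map_eq_one ψ).2 fun h hh => ?_
    obtain ⟨n, k, m, x12, x13, x14, x15, x23, x24, x25, x34, x35, rfl⟩ := hall h
    rw [ψn, ← tG_one, tG_inj] at hh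
    obtain ⟨rfl, rfl, rfl, h12, h13, rfl, h15, h23, rfl, h25, rfl, h35⟩ := hh
    simp only [zPow_zero, mul_one, Int.cast_zero, mul_zero, zero_add] at h12 h13 h15 h23 h25 h35
    subst h12 h13 h15 h23 h25 h35
    simp [Frame.normalForm, OneParam.map_zero]
  · intro g
    obtain ⟨n, k, m, x12, x13, x14, x15, x23, x24, x25, x34, x35, rfl⟩ := exists_eq_tG g
    have hz : ∀ (x : zInvP p) (n : ℤ), x * zPow p (-n) * zPow p n = x := fun x n => by
      rw [mul_assoc, ← zPow_add, neg_add_cancel, zPow_zero, mul_one]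
    refine ⟨F.normalForm n k m (x12 * zPow p (-n)) (x13 * zPow p (-k)) x14 (x15 - x14 * m)
      (x23 * zPow p (-k)) x24 (x25 - x24 * m) x34 (x35 - x34 * m), ?_⟩
    rw [ψn, tG_inj]
    simp [hz]

end

/-! ### Solvability -/

/-- A group is solvable if it has a homomorphism to a commutative monoid with solvable kernel. -/
theorem isSolvable_of_isSolvable_ker {G A : Type*} [Group G] [CommMonoid A] (f : G →* A)
    [Group.IsSolvable f.ker] : Group.IsSolvable G := by
  refine Group.isSolvable_of_ker_le_range f.ker.subtype f.toHomUnits fun g hg => ?_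
  rw [Subgroup.range_subtype, MonoidHom.mem_ker, ← MonoidHom.coe_toHomUnits,
    MonoidHom.mem_ker.1 hg, Units.val_one]

theorem OneParam.pow_eq {p : Nat.Primes} {H : Type*} [Group H] (e : OneParam p H) (x : zInvP p)
    (n : ℕ) : e x ^ n = e (n * x) := by
  induction n with
  | zero => simp [OneParam.map_zero]
  | succ n ih => rw [pow_succ, ih, ← OneParam.map_add, Nat.cast_succ, add_mul, one_mul]

section

variable {p : Nat.Primes}

/-- The homomorphism reading off the diagonal entries and the integer at position `(4, 5)`. -/
noncomputable def tildeGDiagonal (p : Nat.Primes) : tildeG p →* ℚ × ℚ × Multiplicative ℚ where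
  toFun g := ((g.1 : Matrix (Fin 5) (Fin 5) ℚ) 1 1, (g.1 : Matrix (Fin 5) (Fin 5) ℚ) 2 2,
    Multiplicative.ofAdd ((g.1 : Matrix (Fin 5) (Fin 5) ℚ) 3 4))
  map_one' := by
    rw [← tG_one, tG_val]
    simp [tildeGMatrix]
  map_mul' g h := by
    obtain ⟨n, k, m, a12, a13, a14, a15, a23, a24, a25, a34, a35, rfl⟩ := exists_eq_tG g
    obtain ⟨n', k', m', b12, b13, b14, b15, b23, b24, b25, b34, b35, rfl⟩ := exists_eq_tG h
    have hp : (p : ℚ) ≠ 0 := by exact_mod_cast p.2.ne_zero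
    rw [tG_mul, tG_val, tG_val, tG_val]
    simp [tildeGMatrix, zpow_add₀ hp]

theorem exists_eq_tG_of_mem_ker (g : (tildeGDiagonal p).ker) :
    ∃ x12 x13 x14 x15 x23 x24 x25 x34 x35 : zInvP p,
      g.1 = tG 0 0 0 x12 x13 x14 x15 x23 x24 x25 x34 x35 := by
  obtain ⟨g, hg⟩ := g
  obtain ⟨n, k, m, x12, x13, x14, x15, x23, x24, x25, x34, x35, rfl⟩ := exists_eq_tG g
  rw [MonoidHom.mem_ker, ← map_one (tildeGDiagonal p), ← tG_one] at hg
  simp only [tildeGDiagonal, MonoidHom.coe_mk, OneHom.coe_mk, Prod.mk.injEq] at hg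
  obtain ⟨h1, h2, h3⟩ := hg
  have hn : n = 0 := zPow_injective p (Subtype.ext h1)
  have hk : k = 0 := zPow_injective p (Subtype.ext h2)
  have hm : m = 0 := Int.cast_injective (α := ℚ) h3
  subst hn hk hm
  exact ⟨x12, x13, x14, x15, x23, x24, x25, x34, x35, rfl⟩

/-- On the unipotent kernel of `tildeGDiagonal`, the entries at the positions `(1, 2)`, `(2, 3)`,
`(3, 4)`, `(3, 5)` are additive, and where they vanish the group is commutative. -/
noncomputable def tildeGSuperdiagonal (p : Nat.Primes) :
    (tildeGDiagonal p).ker →* Multiplicative (ℚ × ℚ × ℚ × ℚ) where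
  toFun g := Multiplicative.ofAdd ((g.1.1 : Matrix (Fin 5) (Fin 5) ℚ) 0 1,
    (g.1.1 : Matrix (Fin 5) (Fin 5) ℚ) 1 2, (g.1.1 : Matrix (Fin 5) (Fin 5) ℚ) 2 3,
    (g.1.1 : Matrix (Fin 5) (Fin 5) ℚ) 2 4)
  map_one' := by
    rw [Subgroup.coe_one, ← tG_one, tG_val]
    simp only [tildeGMatrix]
    simp
  map_mul' g h := by
    obtain ⟨a12, a13, a14, a15, a23, a24, a25, a34, a35, hg⟩ := exists_eq_tG_of_mem_ker g
    obtain ⟨b12, b13, b14, b15, b23, b24, b25, b34, b35, hh⟩ := exists_eq_tG_of_mem_ker h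
    rw [Subgroup.coe_mul, hg, hh, tG_mul, tG_val, tG_val, tG_val, ← ofAdd_add]
    simp [tildeGMatrix, zPow_zero, add_comm]

instance isSolvable_tildeG : Group.IsSolvable (tildeG p) := by
  have h1 : Group.IsSolvable (tildeGSuperdiagonal p).ker := by
    refine Group.isSolvable_of_comm fun g h => Subtype.ext (Subtype.ext ?_)
    have key : ∀ g : (tildeGSuperdiagonal p).ker, ∃ x13 x14 x15 x24 x25 : zInvP p,
        g.1.1 = tG 0 0 0 0 x13 x14 x15 0 x24 x25 0 0 := by
      intro g
      obtain ⟨x12, x13, x14, x15, x23, x24, x25, x34, x35, hg⟩ := exists_eq_tG_of_mem_ker g.1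
      have h := MonoidHom.mem_ker.1 g.2
      rw [← map_one (tildeGSuperdiagonal p)] at h
      simp only [tildeGSuperdiagonal, MonoidHom.coe_mk, OneHom.coe_mk, hg, Subgroup.coe_one] at h
      have h := Multiplicative.ofAdd.injective h
      simp only [Prod.mk.injEq] at h
      obtain ⟨h1, h2, h3, h4⟩ := h
      have e1 : x12 = 0 := Subtype.ext h1
      have e2 : x23 = 0 := Subtype.ext h2
      have e3 : x34 = 0 := Subtype.ext h3
      have e4 : x35 = 0 := Subtype.ext h4
      subst e1 e2 e3 e4
      exact ⟨x13, x14, x15, x24, x25, hg⟩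
    obtain ⟨a13, a14, a15, a24, a25, hg⟩ := key g
    obtain ⟨b13, b14, b15, b24, b25, hh⟩ := key h
    simp only [Subgroup.coe_mul, hg, hh, tG_mul]
    simp [zPow_zero, add_comm]
  have h2 : Group.IsSolvable (tildeGDiagonal p).ker :=
    isSolvable_of_isSolvable_ker (tildeGSuperdiagonal p)
  exact isSolvable_of_isSolvable_ker (tildeGDiagonal p)

/-! ### Residual finiteness -/

theorem zInvP_den_ne_zero {q : ℕ} [Fact q.Prime] (hq : q ≠ p) (x : zInvP p) :
    (((x : ℚ).den : ℕ) : ZMod q) ≠ 0 := by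
  intro h
  obtain ⟨a, n, hx⟩ := x.2
  rw [ZMod.natCast_eq_zero_iff] at h
  have h1 : ((x : ℚ).den : ℤ) ∣ ((p : ℕ) : ℤ) ^ n := by
    rw [hx]
    have := Rat.den_dvd a (((p : ℕ) : ℤ) ^ n)
    rw [Rat.divInt_eq_div] at this
    exact_mod_cast this
  have h2 : q ∣ (p : ℕ) ^ n := h.trans (by exact_mod_cast h1)
  exact hq ((Nat.prime_dvd_prime_iff_eq Fact.out p.2).1 (Nat.Prime.dvd_of_dvd_pow Fact.out h2))

/-- Reduction of `ℤ[1/p]` modulo another prime `q`. -/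
noncomputable def zInvPReduction (p : Nat.Primes) (q : ℕ) [Fact q.Prime] (hq : q ≠ p) :
    zInvP p →+* ZMod q :=
  have hden := zInvP_den_ne_zero hq
  { toFun := fun x => ((x : ℚ) : ZMod q)
    map_one' := by simp
    map_zero' := by simp
    map_mul' := fun x y => by
      rw [Subring.coe_mul, Rat.cast_mul_of_ne_zero (hden x) (hden y)]
    map_add' := fun x y => by
      rw [Subring.coe_add, Rat.cast_add_of_ne_zero (hden x) (hden y)] }

/-- The matrix of an element of `tildeG p`, over the ring `ℤ[1/p]`. -/
noncomputable def tildeGToMatrix (p : Nat.Primes) : tildeG p →* Matrix (Fin 5) (Fin 5) (zInvP p) :=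
  have hmem : ∀ (g : tildeG p) i j, (g.1 : Matrix (Fin 5) (Fin 5) ℚ) i j ∈ zInvP p := by
    intro g i j
    obtain ⟨n, k, m, x12, x13, x14, x15, x23, x24, x25, x34, x35, rfl⟩ := exists_eq_tG g
    rw [tG_val]
    fin_cases i <;> fin_cases j <;>
      simp [tildeGMatrix, zpow_mem_zInvP, zero_mem, one_mem, intCast_mem]
  { toFun := fun g => Matrix.of fun i j => ⟨(g.1 : Matrix (Fin 5) (Fin 5) ℚ) i j, hmem g i j⟩
    map_one' := by
      ext i j
      by_cases h : i = j <;> simp [Matrix.one_apply, h]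
    map_mul' := fun g h => by
      ext i j
      simp [Matrix.mul_apply] }

instance residuallyFinite_tildeG : Group.ResiduallyFinite (tildeG p) := by
  refine Group.residuallyFinite_of_forall_exists_finite_monoidHom fun g hg => ?_
  obtain ⟨i, j, hij⟩ : ∃ i j, tildeGToMatrix p g i j - (1 : Matrix _ _ (zInvP p)) i j ≠ 0 := by
    by_contra! h
    refine hg (tildeG_ext ?_)
    ext i j
    have := congrArg Subtype.val (sub_eq_zero.1 (h i j))
    rw [← map_one (tildeGToMatrix p)] at this
    exact this
  set x := tildeGToMatrix p g i j - (1 : Matrix _ _ (zInvP p)) i j with hx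
  have hx0 : (x : ℚ) ≠ 0 := fun h => hij (Subtype.ext h)
  -- a prime beyond `p` and the numerator of a nonzero entry of `g - 1`
  obtain ⟨q, hqle, hqp⟩ := Nat.exists_infinite_primes ((x : ℚ).num.natAbs + p + 1)
  have : Fact q.Prime := ⟨hqp⟩
  have hq : q ≠ p := by omega
  let f : tildeG p →* Matrix (Fin 5) (Fin 5) (ZMod q) :=
    ((zInvPReduction p q hq).mapMatrix.toMonoidHom).comp
      (tildeGToMatrix p)
  refine ⟨_, inferInstance, inferInstance, f.toHomUnits, fun h => ?_⟩
  have h1 : f g = 1 := by rw [← MonoidHom.coe_toHomUnits, h, Units.val_one]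
  have h2 : zInvPReduction p q hq x = 0 := by
    have h3 : f g i j = (1 : Matrix _ _ (ZMod q)) i j := by rw [h1]
    rw [← map_one (zInvPReduction p q hq).mapMatrix] at h3
    rw [hx, map_sub, sub_eq_zero]
    exact h3
  have h4 : (((x : ℚ).num : ℤ) : ZMod q) / (((x : ℚ).den : ℕ) : ZMod q) = 0 := by
    rw [← Rat.cast_def]
    exact h2
  rw [div_eq_zero_iff, or_iff_left (zInvP_den_ne_zero hq x),
    ZMod.intCast_zmod_eq_zero_iff_dvd] at h4
  have h5 := Int.natAbs_dvd_natAbs.2 h4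
  have h6 := Nat.le_of_dvd (Int.natAbs_pos.2 (Rat.num_ne_zero.2 hx0)) h5
  simp only [Int.natAbs_natCast] at h6
  omega

instance countable_tildeG : Countable (tildeG p) := by
  have : Countable (Matrix (Fin 5) (Fin 5) ℚ) := inferInstanceAs (Countable (Fin 5 → Fin 5 → ℚ))
  have : Countable (GL (Fin 5) ℚ) :=
    Function.Injective.countable (f := Units.val) Units.val_injective
  infer_instance

/-! ### The center, and distinct primes -/

theorem elem15_mem_center (x : zInvP p) : elem15 p x ∈ Subgroup.center (tildeG p) := by
  refine Subgroup.mem_center_iff.2 fun g => ?_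
  obtain ⟨n, k, m, x12, x13, x14, x15, x23, x24, x25, x34, x35, rfl⟩ := exists_eq_tG g
  simp [elem15, tG_mul, zPow_zero, add_comm]

/-- The center of `tildeG p` is the one-parameter subgroup at position `(1, 5)`. -/
theorem exists_eq_elem15_of_mem_center {g : tildeG p} (hg : g ∈ Subgroup.center (tildeG p)) :
    ∃ x, g = elem15 p x := by
  obtain ⟨n, k, m, x12, x13, x14, x15, x23, x24, x25, x34, x35, rfl⟩ := exists_eq_tG g
  have hg := Subgroup.mem_center_iff.1 hg
  have hp1 : zPow p 1 ≠ 1 := fun h => by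
    rw [← zPow_zero] at h
    exact absurd (zPow_injective p h) (by norm_num)
  have e1 := hg (torusT p 1)
  have e2 := hg (torusS p 1)
  have e3 := hg (elemW p 1)
  have e4 := hg (elem12 p 1)
  have e5 := hg (elem13 p 1)
  have e6 := hg (elem14 p 1)
  simp only [torusT, torusS, elemW, elem12, elem13, elem14, tG_mul, tG_inj] at e1 e2 e3 e4 e5 e6
  simp only [zPow_zero, mul_zero, add_zero, zero_add, mul_one, one_mul, zero_mul, Int.cast_one,
    Int.cast_zero, add_eq_left, right_eq_add, true_and, and_true] at e1 e2 e3 e4 e5 e6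
  have hx : ∀ x : zInvP p, x = x * zPow p 1 → x = 0 := fun x h =>
    (mul_eq_zero.1 (show x * (zPow p 1 - 1) = 0 by
      rw [mul_sub, ← h, mul_one, sub_self])).resolve_right (sub_ne_zero.2 hp1)
  have h12 := hx x12 e1.2.1
  have h13 := hx x13 e2.2.1
  obtain ⟨-, h14, h24, h34⟩ := e3
  obtain ⟨hn, h23, -, h25⟩ := e4
  obtain ⟨hk, -, h35⟩ := e5
  have hn' : n = 0 := zPow_injective p (by rw [zPow_zero]; linear_combination hn)
  have hk' : k = 0 := zPow_injective p (by rw [zPow_zero]; linear_combination hk)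
  have hm : m = 0 := by exact_mod_cast e6.2
  subst h12 h13 h14 h24 h34 h23 h25 h35 hn' hk' hm
  exact ⟨x15, rfl⟩

/-- The center is isomorphic to `ℤ[1/p]`, which is divisible by `p` and by no other prime. -/
theorem isEmpty_mulEquiv_tildeG {p q : Nat.Primes} (hpq : p ≠ q) :
    IsEmpty (tildeG p ≃* tildeG q) := by
  refine ⟨fun φ => ?_⟩
  -- `elem15 q 1` would be the `p`-th power of a central element
  have hz : φ.symm (elem15 q 1) ∈ Subgroup.center (tildeG p) := by
    refine Subgroup.mem_center_iff.2 fun g => φ.injective ?_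
    simpa using Subgroup.mem_center_iff.1 (elem15_mem_center (1 : zInvP q)) (φ g)
  obtain ⟨x, hx⟩ := exists_eq_elem15_of_mem_center hz
  have hy : φ (elem15 p (zPow p (-1) * x)) ∈ Subgroup.center (tildeG q) := by
    refine Subgroup.mem_center_iff.2 fun g => φ.symm.injective ?_
    simpa using Subgroup.mem_center_iff.1 (elem15_mem_center (zPow p (-1) * x)) (φ.symm g)
  obtain ⟨y, hy⟩ := exists_eq_elem15_of_mem_center hy
  have h1 : elem15 p (zPow p (-1) * x) ^ (p : ℕ) = elem15 p x := by
    rw [OneParam.pow_eq]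
    congr 1
    refine Subtype.ext ?_
    simp [zPow, mul_inv_cancel_left₀ (show (p : ℚ) ≠ 0 by exact_mod_cast p.2.ne_zero)]
  have h2 : elem15 q ((p : ℕ) * y) = elem15 q 1 := by
    rw [← OneParam.pow_eq, ← hy, ← map_pow, h1, ← hx, MulEquiv.apply_symm_apply]
  have h3 : ((p : ℕ) : zInvP q) * y = 1 := (tG_inj.1 h2).2.2.2.2.2.2.1
  have : Fact (p : ℕ).Prime := ⟨p.2⟩
  have hpq' : (p : ℕ) ≠ q := fun h => hpq (Subtype.ext h)
  have h4 := congrArg (zInvPReduction q p hpq') h3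
  simp at h4

/-! ### Failure of stability -/

/-- The subgroup of `tildeG p` of integral elements at the positions `(1, 4)` and `(1, 5)`. -/
noncomputable def integralCorner (p : Nat.Primes) : Subgroup (tildeG p) where
  carrier := {g | ∃ a b : ℤ, g = tG 0 0 0 0 0 a b 0 0 0 0 0}
  one_mem' := ⟨0, 0, by simp [tG_one]⟩
  mul_mem' := by
    rintro _ _ ⟨a, b, rfl⟩ ⟨a', b', rfl⟩
    exact ⟨a + a', b + b', by simp [tG_mul, zPow_zero, add_comm]⟩
  inv_mem' := by
    rintro _ ⟨a, b, rfl⟩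
    exact ⟨-a, -b, inv_eq_of_mul_eq_one_left (by simp [tG_mul, zPow_zero, tG_one])⟩

instance normal_integralCorner : (integralCorner p).Normal := by
  refine ⟨?_⟩
  rintro _ ⟨a, b, rfl⟩ g
  obtain ⟨n, k, m, x12, x13, x14, x15, x23, x24, x25, x34, x35, rfl⟩ := exists_eq_tG g
  refine ⟨a, b - a * m, ?_⟩
  rw [mul_inv_eq_iff_eq_mul, tG_mul, tG_mul, tG_inj]
  simp [zPow_zero, add_comm]

/-- The quotient by `integralCorner p` kills `elem14 p 1` but not the central
`elem15 p (-1 / p)`. -/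
theorem not_isLocallyHSStable_tildeG : ¬ IsLocallyHSStable (tildeG p) := by
  have : Countable (tildeG p ⧸ integralCorner p) := Quotient.countable
  refine not_isLocallyHSStable_of_central_roots (Q := tildeG p ⧸ integralCorner p) p.2
    (fun j => elem14 p (zPow p (-j))) (fun j => elem15 p (-zPow p (-j))) (elemW p 1)
    (fun j => ?_) (fun j => ?_) (fun j => ?_) (fun j => ?_) (hasFoelnerSets_of_isSolvable _)
    (QuotientGroup.mk' _) ?_ ?_
  · rw [OneParam.pow_eq]
    congr 1
    refine Subtype.ext ?_
    have hp : (p : ℚ) ≠ 0 := by exact_mod_cast p.2.ne_zero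
    simp [zPow, zpow_add₀ hp, mul_inv_cancel_left₀ hp]
  · exact (Subgroup.mem_center_iff.1 (elem15_mem_center _) _).symm
  · exact (Subgroup.mem_center_iff.1 (elem15_mem_center _) _).symm
  · simp [elem14, elem15, elemW, tG_mul, zPow_zero]
  · rw [QuotientGroup.mk'_apply, QuotientGroup.eq_one_iff]
    exact ⟨1, 0, by simp [elem14, zPow_zero]⟩
  · rw [QuotientGroup.mk'_apply, ne_eq, QuotientGroup.eq_one_iff]
    rintro ⟨a, b, h⟩
    have h1 : -zPow p (-1) = (b : zInvP p) := (tG_inj.1 h).2.2.2.2.2.2.1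
    have h2 : -((p : ℚ))⁻¹ = b := by
      have := congrArg Subtype.val h1
      simpa [zPow] using this
    have hp : (p : ℚ) ≠ 0 := by exact_mod_cast p.2.ne_zero
    have h3 : (-1 : ℚ) = b * (p : ℕ) := by
      rw [← h2, neg_mul, inv_mul_cancel₀ hp]
    have h4 : (-1 : ℤ) = b * (p : ℕ) := by exact_mod_cast h3
    have h5 : ((p : ℕ) : ℤ) ∣ 1 := ⟨-b, by linarith⟩
    exact p.2.one_lt.ne' (by exact_mod_cast Int.eq_one_of_dvd_one (by positivity) h5)

end

theorem theoremB :
    (Set.range tildeG).Infinite ∧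
    (∀ p q : Nat.Primes, p ≠ q → IsEmpty (tildeG p ≃* tildeG q)) ∧
    ∀ p : Nat.Primes,
      Group.IsFinitelyPresented (tildeG p) ∧
      Group.IsSolvable (tildeG p) ∧
      Group.ResiduallyFinite (tildeG p) ∧
      ¬ IsLocallyHSStable (tildeG p) ∧
      ¬ IsHSStable (tildeG p) := by
  refine ⟨Set.infinite_range_of_injective fun p q h => ?_, fun p q => isEmpty_mulEquiv_tildeG,
    fun p => ⟨inferInstance, inferInstance, inferInstance, not_isLocallyHSStable_tildeG,
      fun h => not_isLocallyHSStable_tildeG h.isLocallyHSStable⟩⟩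
  by_contra hpq
  exact (isEmpty_mulEquiv_tildeG hpq).false (MulEquiv.subgroupCongr h)
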